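/- **Conventions.** Let $\mathcal C$ be a monoidal category with unit object $\mathbb 1$. A *bimonad* on $\mathcal C$ is a monad $(T,\mu,\eta)$ on $\mathcal C$ whose endofunctor is comonoidal, with structure $T_2(X,Y)\colon T(X\otimes Y)\to TX\otimes TY$ and $T_0\colon T\mathbb 1\to\mathbb 1$, and such that $\mu$ and $\eta$ are comonoidal. A morphism of bimonads is a comonoidal morphism of monads. A *Hopf monad* is a bimonad for which the fusion operators $$H^l_{X,Y}=(TX\otimes\mu_Y)\,T_2(X,TY)\colon T(X\otimes TY)\to TX\otimes TY,\qquad H^r_{X,Y}=(\mu_X\otimes TY)\,T_2(TX,Y)\colon T(TX\otimes Y)\to TX\otimes TY$$ are invertible for all objects $X,Y$; morphisms of Hopf monads are morphisms of bimonads. The category $\mathcal C^T$ of $T$-modules is monoidal, with $(M,r)\otimes(N,s)=(M\otimes N,(r\otimes s)T_2(M,N))$ and unit $(\mathbb 1,T_0)$. Write $F_T\dashv U_T$ for the free/forgetful adjunction. A *central Hopf algebra* of a monoidal category $\mathcal D$ is a Hopf algebra $(A,\sigma)$, with invertible antipode, in the braided category $\mathcal Z(\mathcal D)$, the center of $\mathcal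 D$ (here $\sigma\colon A\otimes ?\to ?\otimes A$ is the invertible half-braiding). With product $m$, unit $u$, coproduct $\Delta$ and counit $\varepsilon$, it defines a bimonad $A\otimes_\sigma ?$ on $\mathcal D$: the endofunctor $A\otimes ?$ with product $m\otimes X$, unit $u\otimes X$, comonoidal structure $(A\otimes\sigma_X\otimes Y)(\Delta\otimes X\otimes Y)$ and $\varepsilon$. If $Q$ is a bimonad on $\mathcal C^T$, the *cross product* $Q\rtimes T$ is the bimonad on $\mathcal C$ of the composite comonoidal adjunction $(F_QF_T,U_TU_Q)$; its endofunctor is $U_TQF_T$. For a central Hopf algebra $(\mathbb A,\sigma)$ of $\mathcal C^T$ put $\mathbb A\rtimes_\sigma T=(\mathbb A\otimes_\sigma ?)\rtimes T$. The unit $u$ and counit $\varepsilon$ of $\mathbb A$ give morphisms of bimonads $\iota=u\otimes T\colon T\to\mathbb A\rtimes_\sigma T$ and $\pi=\varepsilon\otimes T\colon\mathbb A\rtimes_\sigma T\to T$. **Statement.** Let $P$ and $T$ be Hopf monads on a monoidal category $\mathcal C$ such that $T$ is a retract of $P$: there are given morphisms of Hopf monads $f\colon T\to P$ and $g\colon P\to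 T$ with $gf=\mathrm{id}_T$. Assume that reflexive coequalizers (coequalizers of parallel pairs having a common section) exist in $\mathcal C$ and are preserved by $P$ and by the monoidal product of $\mathcal C$, that is, by $X\otimes ?$ and by $?\otimes X$ for every object $X$. Then there exist a central Hopf algebra $(\mathbb A,\sigma)$ of $\mathcal C^T$ and an isomorphism of Hopf monads $\varphi\colon P\xrightarrow{\ \sim\ }\mathbb A\rtimes_\sigma T$ (in particular $\mathbb A\rtimes_\sigma T$ is a Hopf monad) such that $$\varphi f=\iota,\qquad \pi\varphi=g,\qquad \pi\iota=\mathrm{id}_T .$$ -/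

import Mathlib

universe v u

namespace CategoryTheory

open MonoidalCategory

section Basic

variable (C : Type u) [Category.{v} C] [MonoidalCategory C]

/-- A bimonad (opmonoidal monad) on a monoidal category: a monad `(T, μ, η)` whose endofunctor is
comonoidal (oplax monoidal) and whose product and unit are comonoidal natural transformations.
Here `δ X Y : T (X ⊗ Y) ⟶ T X ⊗ T Y` and `Functor.OplaxMonoidal.η T : T 𝟙_ ⟶ 𝟙_` are the comonoidal
structure (usually written `T₂` and `T₀`). -/
structure Bimonad extends Monad C where
  [oplax : toFunctor.OplaxMonoidal]
  μ_δ : ∀ X Y : C,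
    μ.app (X ⊗ Y) ≫ Functor.OplaxMonoidal.δ toFunctor X Y =
      toFunctor.map (Functor.OplaxMonoidal.δ toFunctor X Y) ≫
        Functor.OplaxMonoidal.δ toFunctor (toFunctor.obj X) (toFunctor.obj Y) ≫
          (μ.app X ⊗ₘ μ.app Y)
  μ_counit :
    μ.app (𝟙_ C) ≫ Functor.OplaxMonoidal.η toFunctor =
      toFunctor.map (Functor.OplaxMonoidal.η toFunctor) ≫ Functor.OplaxMonoidal.η toFunctor
  η_δ : ∀ X Y : C,
    η.app (X ⊗ Y) ≫ Functor.OplaxMonoidal.δ toFunctor X Y = (η.app X ⊗ₘ η.app Y)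
  η_counit : η.app (𝟙_ C) ≫ Functor.OplaxMonoidal.η toFunctor = 𝟙 (𝟙_ C)

attribute [instance] Bimonad.oplax

end Basic

namespace Bimonad

variable {C : Type u} [Category.{v} C] [MonoidalCategory C]

open Functor.OplaxMonoidal (δ)

/-- Morphisms of bimonads: comonoidal morphisms of monads. -/
@[ext]
structure Hom (T P : Bimonad C) extends MonadHom T.toMonad P.toMonad where
  app_δ : ∀ X Y : C, app (X ⊗ Y) ≫ δ P.toFunctor X Y = δ T.toFunctor X Y ≫ (app X ⊗ₘ app Y)
  app_counit : app (𝟙_ C) ≫ Functor.OplaxMonoidal.η P.toFunctor = Functor.OplaxMonoidal.η T.toFunctor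

instance : Category (Bimonad C) where
  Hom T P := Hom T P
  id T :=
    { toMonadHom := 𝟙 T.toMonad
      app_δ := fun X Y => by simp
      app_counit := by simp }
  comp {T P Q} f g :=
    { toMonadHom :=
        (show T.toMonad ⟶ P.toMonad from f.toMonadHom) ≫
          (show P.toMonad ⟶ Q.toMonad from g.toMonadHom)
      app_δ := fun X Y => by
        have h1 := f.app_δ X Y
        have h2 := g.app_δ X Y
        simp [h2, reassoc_of% h1]
      app_counit := by
        have h1 := f.app_counit
        have h2 := g.app_counit
        simp [h2, h1] }

@[simp] theorem id_app (T : Bimonad C) (X : C) : (𝟙 T : T ⟶ T).app X = 𝟙 (T.obj X) := rfl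

@[simp] theorem comp_app {T P Q : Bimonad C} (f : T ⟶ P) (g : P ⟶ Q) (X : C) :
    (f ≫ g).app X = f.app X ≫ g.app X := rfl

@[ext] theorem hom_ext {T P : Bimonad C} {f g : T ⟶ P} (h : ∀ X, f.app X = g.app X) : f = g := by
  apply Hom.ext
  funext X
  exact h X

/-- The component `η_X : X ⟶ T X` of the unit of a bimonad. -/
def unitApp (T : Bimonad C) (X : C) : X ⟶ T.obj X := T.η.app X

/-- The component `μ_X : T (T X) ⟶ T X` of the product of a bimonad. -/
def prodApp (T : Bimonad C) (X : C) : T.obj (T.obj X) ⟶ T.obj X := T.μ.app X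

section

variable (T : Bimonad C)

theorem unitApp_naturality {X Y : C} (f : X ⟶ Y) : f ≫ T.unitApp Y = T.unitApp X ≫ T.map f :=
  T.η.naturality f

theorem prodApp_naturality {X Y : C} (f : X ⟶ Y) :
    T.map (T.map f) ≫ T.prodApp Y = T.prodApp X ≫ T.map f :=
  T.μ.naturality f

theorem prodApp_assoc (X : C) :
    T.map (T.prodApp X) ≫ T.prodApp X = T.prodApp (T.obj X) ≫ T.prodApp X :=
  T.toMonad.assoc X

@[simp]
theorem unitApp_prodApp (X : C) : T.unitApp (T.obj X) ≫ T.prodApp X = 𝟙 _ :=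
  T.toMonad.left_unit X

@[simp]
theorem map_unitApp_prodApp (X : C) : T.map (T.unitApp X) ≫ T.prodApp X = 𝟙 _ :=
  T.toMonad.right_unit X

theorem prodApp_δ (X Y : C) : T.prodApp (X ⊗ Y) ≫ δ T.toFunctor X Y =
    T.map (δ T.toFunctor X Y) ≫ δ T.toFunctor (T.obj X) (T.obj Y) ≫
      (T.prodApp X ⊗ₘ T.prodApp Y) :=
  T.μ_δ X Y

theorem prodApp_counit : T.prodApp (𝟙_ C) ≫ Functor.OplaxMonoidal.η T.toFunctor =
    T.map (Functor.OplaxMonoidal.η T.toFunctor) ≫ Functor.OplaxMonoidal.η T.toFunctor :=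
  T.μ_counit

theorem unitApp_δ (X Y : C) :
    T.unitApp (X ⊗ Y) ≫ δ T.toFunctor X Y = (T.unitApp X ⊗ₘ T.unitApp Y) :=
  T.η_δ X Y

theorem unitApp_counit : T.unitApp (𝟙_ C) ≫ Functor.OplaxMonoidal.η T.toFunctor = 𝟙 (𝟙_ C) :=
  T.η_counit

end

/-- The left fusion operator `H^l_{X,Y} = (T X ⊗ μ_Y) T₂(X, T Y)`. -/
def leftFusion (T : Bimonad C) (X Y : C) : T.obj (X ⊗ T.obj Y) ⟶ T.obj X ⊗ T.obj Y :=
  δ T.toFunctor X (T.obj Y) ≫ T.obj X ◁ T.μ.app Y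

/-- The right fusion operator `H^r_{X,Y} = (μ_X ⊗ T Y) T₂(T X, Y)`. -/
def rightFusion (T : Bimonad C) (X Y : C) : T.obj (T.obj X ⊗ Y) ⟶ T.obj X ⊗ T.obj Y :=
  δ T.toFunctor (T.obj X) Y ≫ T.μ.app X ▷ T.obj Y

/-- A Hopf monad is a bimonad whose left and right fusion operators are invertible. -/
structure IsHopf (T : Bimonad C) : Prop where
  isIso_leftFusion : ∀ X Y : C, IsIso (T.leftFusion X Y)
  isIso_rightFusion : ∀ X Y : C, IsIso (T.rightFusion X Y)

/-! ### The monoidal category of modules over a bimonad -/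

section Modules

variable (T : Bimonad C)

/-- The category of `T`-modules. -/
abbrev Mod (T : Bimonad C) := T.toMonad.Algebra

/-- The monoidal product of `T`-modules:
`(M, r) ⊗ (N, s) = (M ⊗ N, (r ⊗ s) T₂(M, N))`, with unit `(𝟙_, T₀)`. -/
def tensorMod {T : Bimonad C} (M N : T.Mod) : T.Mod where
  A := M.A ⊗ N.A
  a := δ T.toFunctor M.A N.A ≫ (M.a ⊗ₘ N.a)
  unit := by
    rw [← Category.assoc, T.η_δ, tensorHom_comp_tensorHom, M.unit, N.unit]
    simp
  assoc := by
    have h := Functor.OplaxMonoidal.δ_natural T.toFunctor M.a N.a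
    rw [reassoc_of% T.μ_δ, tensorHom_comp_tensorHom, M.assoc, N.assoc,
      ← tensorHom_comp_tensorHom, reassoc_of% h, Functor.map_comp, Category.assoc]

/-- The unit `T`-module `(𝟙_, T₀)`. -/
def unitMod (T : Bimonad C) : T.Mod where
  A := 𝟙_ C
  a := Functor.OplaxMonoidal.η T.toFunctor
  unit := T.η_counit
  assoc := T.μ_counit

/-- The monoidal product of `T`-linear morphisms. -/
def tensorModHom {T : Bimonad C} {M M' N N' : T.Mod} (f : M ⟶ M') (g : N ⟶ N') :
    tensorMod M N ⟶ tensorMod M' N' where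
  f := f.f ⊗ₘ g.f
  h := by
    have h := Functor.OplaxMonoidal.δ_natural T.toFunctor f.f g.f
    simp [tensorMod, ← reassoc_of% h, tensorHom_comp_tensorHom]

instance : MonoidalCategoryStruct T.Mod where
  tensorObj M N := tensorMod M N
  tensorUnit := unitMod T
  tensorHom f g := tensorModHom f g
  whiskerLeft M _ _ g :=
    { f := M.A ◁ g.f
      h := by
        have h := (tensorModHom (𝟙 M) g).h
        simpa only [tensorModHom, Monad.Algebra.id_f, id_tensorHom] using h }
  whiskerRight f N :=
    { f := f.f ▷ N.A
      h := by
        have h := (tensorModHom f (𝟙 N)).h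
        simpa only [tensorModHom, Monad.Algebra.id_f, tensorHom_id] using h }
  associator L M N := Monad.Algebra.isoMk (α_ L.A M.A N.A) (by
    have h := Functor.OplaxMonoidal.oplax_associativity T.toFunctor L.A M.A N.A
    simp only [tensorMod]
    have h1 : (L.a ⊗ₘ (δ T.toFunctor M.A N.A ≫ (M.a ⊗ₘ N.a))) =
        T.obj L.A ◁ δ T.toFunctor M.A N.A ≫ (L.a ⊗ₘ (M.a ⊗ₘ N.a)) := by
      rw [← id_tensorHom, tensorHom_comp_tensorHom, Category.id_comp]
    have h2 : ((δ T.toFunctor L.A M.A ≫ (L.a ⊗ₘ M.a)) ⊗ₘ N.a) =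
        δ T.toFunctor L.A M.A ▷ T.obj N.A ≫ ((L.a ⊗ₘ M.a) ⊗ₘ N.a) := by
      rw [← tensorHom_id, tensorHom_comp_tensorHom, Category.id_comp]
    rw [h1, h2]
    simp only [Category.assoc, associator_naturality]
    rw [reassoc_of% h])
  leftUnitor M := Monad.Algebra.isoMk (λ_ M.A) (by
    have h := Functor.OplaxMonoidal.left_unitality_hom T.toFunctor M.A
    simp only [tensorMod, unitMod]
    rw [← h, MonoidalCategory.tensorHom_def]
    simp)
  rightUnitor M := Monad.Algebra.isoMk (ρ_ M.A) (by
    have h := Functor.OplaxMonoidal.right_unitality_hom T.toFunctor M.A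
    simp only [tensorMod, unitMod]
    rw [← h, MonoidalCategory.tensorHom_def']
    simp)

@[simp] theorem tensorObj_A (M N : T.Mod) : (M ⊗ N).A = M.A ⊗ N.A := rfl
@[simp] theorem tensorObj_a (M N : T.Mod) :
    (M ⊗ N).a = δ T.toFunctor M.A N.A ≫ (M.a ⊗ₘ N.a) := rfl
@[simp] theorem tensorUnit_A : (𝟙_ T.Mod).A = 𝟙_ C := rfl
@[simp] theorem tensorUnit_a : (𝟙_ T.Mod).a = Functor.OplaxMonoidal.η T.toFunctor := rfl
@[simp] theorem tensorHom_f {M M' N N' : T.Mod} (f : M ⟶ M') (g : N ⟶ N') :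
    (f ⊗ₘ g).f = f.f ⊗ₘ g.f := rfl
@[simp] theorem whiskerLeft_f (M : T.Mod) {N N' : T.Mod} (g : N ⟶ N') :
    (M ◁ g).f = M.A ◁ g.f := rfl
@[simp] theorem whiskerRight_f {M M' : T.Mod} (f : M ⟶ M') (N : T.Mod) :
    (f ▷ N).f = f.f ▷ N.A := rfl
@[simp] theorem associator_hom_f (L M N : T.Mod) :
    (α_ L M N).hom.f = (α_ L.A M.A N.A).hom := rfl
@[simp] theorem associator_inv_f (L M N : T.Mod) :
    (α_ L M N).inv.f = (α_ L.A M.A N.A).inv := rfl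
@[simp] theorem leftUnitor_hom_f (M : T.Mod) : (λ_ M).hom.f = (λ_ M.A).hom := rfl
@[simp] theorem leftUnitor_inv_f (M : T.Mod) : (λ_ M).inv.f = (λ_ M.A).inv := rfl
@[simp] theorem rightUnitor_hom_f (M : T.Mod) : (ρ_ M).hom.f = (ρ_ M.A).hom := rfl
@[simp] theorem rightUnitor_inv_f (M : T.Mod) : (ρ_ M).inv.f = (ρ_ M.A).inv := rfl

instance : MonoidalCategory T.Mod where
  tensorHom_def f g := by ext; simp [MonoidalCategory.tensorHom_def]
  id_tensorHom_id M N := by ext; simp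
  tensorHom_comp_tensorHom f g h k := by ext; simp
  whiskerLeft_id M N := by ext; simp
  id_whiskerRight M N := by ext; simp
  associator_naturality f g h := by ext; simp
  leftUnitor_naturality f := by ext; simp
  rightUnitor_naturality f := by ext; simp
  pentagon L M N K := by ext; simp
  triangle M N := by ext; simp

/-- The comonoidal structure of the free module functor `F_T`. -/
instance freeOplax : T.toMonad.free.OplaxMonoidal where
  δ X Y :=
    { f := δ T.toFunctor X Y
      h := (T.μ_δ X Y).symm }
  η :=
    { f := Functor.OplaxMonoidal.η T.toFunctor
      h := T.μ_counit.symm }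
  δ_natural_left f X := by
    ext
    have h := Functor.OplaxMonoidal.δ_natural_left T.toFunctor f X
    exact h
  δ_natural_right X f := by
    ext
    have h := Functor.OplaxMonoidal.δ_natural_right T.toFunctor X f
    exact h
  oplax_associativity X Y Z := by
    ext
    have h := Functor.OplaxMonoidal.oplax_associativity T.toFunctor X Y Z
    exact h
  oplax_left_unitality X := by
    ext
    have h := Functor.OplaxMonoidal.oplax_left_unitality T.toFunctor X
    exact h
  oplax_right_unitality X := by
    ext
    have h := Functor.OplaxMonoidal.oplax_right_unitality T.toFunctor X
    exact h

variable {T}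

theorem free_δ_f (X Y : C) : (δ T.toMonad.free X Y).f = δ T.toFunctor X Y := rfl

theorem free_counit_f :
    (Functor.OplaxMonoidal.η T.toMonad.free).f = Functor.OplaxMonoidal.η T.toFunctor := rfl

/-- The counit `ε_M : F_T U_T M ⟶ M` of the adjunction `(F_T, U_T)`; its underlying morphism is the
action of `T` on `M`. -/
def modCounit (M : T.Mod) : T.toMonad.free.obj M.A ⟶ M where
  f := M.a
  h := M.assoc.symm

theorem modCounit_naturality {M N : T.Mod} (f : M ⟶ N) :
    T.toMonad.free.map f.f ≫ modCounit N = modCounit M ≫ f := by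
  ext
  exact f.h

theorem free_δ_modCounit (M N : T.Mod) :
    δ T.toMonad.free M.A N.A ≫ (modCounit M ⊗ₘ modCounit N) = modCounit (M ⊗ N) := rfl

theorem free_counit_modCounit :
    Functor.OplaxMonoidal.η T.toMonad.free = modCounit (𝟙_ T.Mod) := rfl

end Modules

/-! ### Cross products -/

section CrossProduct

variable {T : Bimonad C} (Q : Bimonad T.Mod)

/-- The free `T`-module `F_T X = (T X, μ_X)`. -/
abbrev freeMod (T : Bimonad C) (X : C) : T.Mod := T.toMonad.free.obj X

/-- The product `q_{F_T X} Q(ε_{Q F_T X})` of the cross product, as a `T`-linear morphism. -/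
def crossProd (X : C) :
    Q.obj (T.freeMod (Q.obj (T.freeMod X)).A) ⟶ Q.obj (T.freeMod X) :=
  Q.map (modCounit (Q.obj (T.freeMod X))) ≫ Q.prodApp (T.freeMod X)

theorem crossProd_naturality {X Y : C} (f : X ⟶ Y) :
    Q.map (T.toMonad.free.map (Q.map (T.toMonad.free.map f)).f) ≫ crossProd Q Y =
      crossProd Q X ≫ Q.map (T.toMonad.free.map f) := by
  rw [crossProd, crossProd, ← Functor.map_comp_assoc, modCounit_naturality, Functor.map_comp,
    Category.assoc, Category.assoc, prodApp_naturality]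

theorem crossProd_assoc (X : C) :
    Q.map (T.toMonad.free.map (crossProd Q X).f) ≫ crossProd Q X =
      crossProd Q (Q.obj (T.freeMod X)).A ≫ crossProd Q X := by
  conv_lhs => rw [crossProd, ← Functor.map_comp_assoc, ← crossProd, modCounit_naturality]
  simp only [crossProd, Functor.map_comp, Category.assoc]
  rw [Q.prodApp_assoc, ← reassoc_of% Q.prodApp_naturality]

theorem unit_crossProd (X : C) :
    Q.unitApp (T.freeMod (Q.obj (T.freeMod X)).A) ≫ crossProd Q X =
      modCounit (Q.obj (T.freeMod X)) := by
  rw [crossProd, ← reassoc_of% Q.unitApp_naturality, unitApp_prodApp, Category.comp_id]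

/-- The unit `η_X : X ⟶ U_T F_T X` of the adjunction `(F_T, U_T)`. -/
def freeUnit (T : Bimonad C) (X : C) : X ⟶ (T.freeMod X).A := T.unitApp X

theorem free_map_freeUnit_modCounit (X : C) :
    T.toMonad.free.map (T.freeUnit X) ≫ modCounit (T.freeMod X) = 𝟙 (T.freeMod X) := by
  ext
  exact T.toMonad.right_unit X

theorem map_unit_crossProd (X : C) :
    Q.map (T.toMonad.free.map (Q.unitApp (T.freeMod X)).f) ≫ crossProd Q X =
      Q.map (modCounit (T.freeMod X)) := by
  rw [crossProd, ← Functor.map_comp_assoc, modCounit_naturality, Functor.map_comp, Category.assoc,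
    map_unitApp_prodApp, Category.comp_id]

/-- The cross product of monads: the monad of the composite adjunction
`(F_Q F_T, U_T U_Q)`. As an endofunctor it is `U_T Q F_T`, with product
`q_{F_T} Q(ε_{Q F_T})` and unit `v_{F_T} η`, where `q` and `v` are the product and unit of `Q`. -/
def crossMonad : Monad C where
  toFunctor := T.toMonad.free ⋙ Q.toFunctor ⋙ T.toMonad.forget
  η :=
    { app := fun X => T.freeUnit X ≫ (Q.unitApp (T.freeMod X)).f
      naturality := fun X Y f => by
        have h : T.map f ≫ (Q.unitApp (T.freeMod Y)).f =
            (Q.unitApp (T.freeMod X)).f ≫ (Q.map (T.toMonad.free.map f)).f :=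
          congrArg Monad.Algebra.Hom.f (Q.unitApp_naturality (T.toMonad.free.map f))
        have h0 : f ≫ T.freeUnit Y = T.freeUnit X ≫ T.map f := T.unitApp_naturality f
        exact (((Category.assoc _ _ _).symm.trans
          (congrArg (· ≫ (Q.unitApp (T.freeMod Y)).f) h0)).trans
            ((Category.assoc _ _ _).trans (congrArg (T.freeUnit X ≫ ·) h))).trans
          (Category.assoc _ _ _).symm }
  μ :=
    { app := fun X => (crossProd Q X).f
      naturality := fun X Y f =>
        congrArg Monad.Algebra.Hom.f (crossProd_naturality Q f) }
  assoc X := congrArg Monad.Algebra.Hom.f (crossProd_assoc Q X)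
  left_unit X := by
    have h : (Q.unitApp (T.freeMod (Q.obj (T.freeMod X)).A)).f ≫ (crossProd Q X).f =
        (Q.obj (T.freeMod X)).a :=
      congrArg Monad.Algebra.Hom.f (unit_crossProd Q X)
    exact (Category.assoc _ _ _).trans
      ((congrArg (T.freeUnit _ ≫ ·) h).trans (Q.obj (T.freeMod X)).unit)
  right_unit X := by
    have h : Q.map (T.toMonad.free.map (T.freeUnit X ≫ (Q.unitApp (T.freeMod X)).f)) ≫
        crossProd Q X = 𝟙 (Q.obj (T.freeMod X)) := by
      rw [Functor.map_comp, Functor.map_comp, Category.assoc, map_unit_crossProd,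
        ← Functor.map_comp, free_map_freeUnit_modCounit, Functor.map_id]
    exact congrArg Monad.Algebra.Hom.f h

/-- The comonoidal structure of `Q F_T`. -/
def crossδ (X Y : C) : Q.obj (T.freeMod (X ⊗ Y)) ⟶ Q.obj (T.freeMod X) ⊗ Q.obj (T.freeMod Y) :=
  Q.map (δ T.toMonad.free X Y) ≫ δ Q.toFunctor (T.freeMod X) (T.freeMod Y)

/-- The counit of `Q F_T`. -/
def crossCounit : Q.obj (T.freeMod (𝟙_ C)) ⟶ 𝟙_ T.Mod :=
  Q.map (Functor.OplaxMonoidal.η T.toMonad.free) ≫ Functor.OplaxMonoidal.η Q.toFunctor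

/-- `crossδ` at the objects underlying two `T`-modules. -/
def crossδMod (M N : T.Mod) :
    Q.obj (T.freeMod (M ⊗ N).A) ⟶ Q.obj (T.freeMod M.A) ⊗ Q.obj (T.freeMod N.A) :=
  crossδ Q M.A N.A

/-- `crossCounit` at the object underlying the unit `T`-module. -/
def crossCounitMod : Q.obj (T.freeMod (𝟙_ T.Mod).A) ⟶ 𝟙_ T.Mod := crossCounit Q

theorem crossδMod_modCounit (M N : T.Mod) :
    crossδMod Q M N ≫ (Q.map (modCounit M) ⊗ₘ Q.map (modCounit N)) =
      Q.map (modCounit (M ⊗ N)) ≫ δ Q.toFunctor M N := by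
  have h : crossδ Q M.A N.A ≫ (Q.map (modCounit M) ⊗ₘ Q.map (modCounit N)) =
      Q.map (δ T.toMonad.free M.A N.A ≫ (modCounit M ⊗ₘ modCounit N)) ≫ δ Q.toFunctor M N := by
    rw [crossδ, Category.assoc, Functor.OplaxMonoidal.δ_natural, Functor.map_comp, Category.assoc]
  exact h

theorem crossCounitMod_eq :
    crossCounitMod Q = Q.map (modCounit (𝟙_ T.Mod)) ≫ Functor.OplaxMonoidal.η Q.toFunctor := rfl

theorem crossProd_crossδ (X Y : C) :
    crossProd Q (X ⊗ Y) ≫ crossδ Q X Y =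
      Q.map (T.toMonad.free.map (crossδ Q X Y).f) ≫
        crossδMod Q (Q.obj (T.freeMod X)) (Q.obj (T.freeMod Y)) ≫
          (crossProd Q X ⊗ₘ crossProd Q Y) := by
  have h1 : crossδMod Q (Q.obj (T.freeMod X)) (Q.obj (T.freeMod Y)) ≫
        (crossProd Q X ⊗ₘ crossProd Q Y) =
      Q.map (modCounit (Q.obj (T.freeMod X) ⊗ Q.obj (T.freeMod Y))) ≫
        δ Q.toFunctor _ _ ≫ (Q.prodApp (T.freeMod X) ⊗ₘ Q.prodApp (T.freeMod Y)) := by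
    rw [crossProd, crossProd, ← tensorHom_comp_tensorHom, reassoc_of% crossδMod_modCounit]
  rw [h1, ← Functor.map_comp_assoc, modCounit_naturality]
  simp only [crossProd, crossδ, Functor.map_comp, Category.assoc]
  rw [← reassoc_of% Q.prodApp_naturality, prodApp_δ]

theorem crossProd_crossCounit :
    crossProd Q (𝟙_ C) ≫ crossCounit Q =
      Q.map (T.toMonad.free.map (crossCounit Q).f) ≫ crossCounitMod Q := by
  rw [crossCounitMod_eq, ← Functor.map_comp_assoc, modCounit_naturality]
  simp only [crossProd, crossCounit, Functor.map_comp, Category.assoc]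
  rw [← reassoc_of% Q.prodApp_naturality, prodApp_counit]

theorem unit_crossδ (X Y : C) :
    Q.unitApp (T.freeMod (X ⊗ Y)) ≫ crossδ Q X Y =
      δ T.toMonad.free X Y ≫ (Q.unitApp (T.freeMod X) ⊗ₘ Q.unitApp (T.freeMod Y)) := by
  rw [crossδ, ← reassoc_of% Q.unitApp_naturality, unitApp_δ]

theorem unit_crossCounit :
    Q.unitApp (T.freeMod (𝟙_ C)) ≫ crossCounit Q = Functor.OplaxMonoidal.η T.toMonad.free := by
  rw [crossCounit, ← reassoc_of% Q.unitApp_naturality, unitApp_counit, Category.comp_id]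

theorem freeUnit_δ (X Y : C) :
    T.freeUnit (X ⊗ Y) ≫ (δ T.toMonad.free X Y).f = (T.freeUnit X ⊗ₘ T.freeUnit Y) :=
  T.η_δ X Y

/-- The comonoidal structure of `U_T Q F_T`. -/
instance crossOplax : (crossMonad Q).toFunctor.OplaxMonoidal where
  δ X Y := (crossδ Q X Y).f
  η := (crossCounit Q).f
  δ_natural_left f X := congrArg Monad.Algebra.Hom.f
    (Functor.OplaxMonoidal.δ_natural_left (T.toMonad.free ⋙ Q.toFunctor) f X)
  δ_natural_right X f := congrArg Monad.Algebra.Hom.f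
    (Functor.OplaxMonoidal.δ_natural_right (T.toMonad.free ⋙ Q.toFunctor) X f)
  oplax_associativity X Y Z := congrArg Monad.Algebra.Hom.f
    (Functor.OplaxMonoidal.oplax_associativity (T.toMonad.free ⋙ Q.toFunctor) X Y Z)
  oplax_left_unitality X := congrArg Monad.Algebra.Hom.f
    (Functor.OplaxMonoidal.oplax_left_unitality (T.toMonad.free ⋙ Q.toFunctor) X)
  oplax_right_unitality X := congrArg Monad.Algebra.Hom.f
    (Functor.OplaxMonoidal.oplax_right_unitality (T.toMonad.free ⋙ Q.toFunctor) X)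

/-- The cross product `Q ⋊ T` of a bimonad `T` on `C` by a bimonad `Q` on the monoidal category of
`T`-modules, a bimonad on `C`. -/
def cross : Bimonad C where
  toMonad := crossMonad Q
  oplax := crossOplax Q
  μ_δ X Y := congrArg Monad.Algebra.Hom.f (crossProd_crossδ Q X Y)
  μ_counit := congrArg Monad.Algebra.Hom.f (crossProd_crossCounit Q)
  η_δ X Y := by
    have h := congrArg Monad.Algebra.Hom.f (unit_crossδ Q X Y)
    have h' : (T.freeUnit X ⊗ₘ T.freeUnit Y) ≫
        ((Q.unitApp (T.freeMod X)).f ⊗ₘ (Q.unitApp (T.freeMod Y)).f) =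
        (T.freeUnit X ≫ (Q.unitApp (T.freeMod X)).f) ⊗ₘ
          (T.freeUnit Y ≫ (Q.unitApp (T.freeMod Y)).f) :=
      tensorHom_comp_tensorHom _ _ _ _
    have h'' := congrArg
      (· ≫ ((Q.unitApp (T.freeMod X)).f ⊗ₘ (Q.unitApp (T.freeMod Y)).f)) (freeUnit_δ (T := T) X Y)
    exact (Category.assoc _ _ _).trans ((congrArg (T.freeUnit (X ⊗ Y) ≫ ·) h).trans
      ((Category.assoc _ _ _).symm.trans (h''.trans h')))
  η_counit :=
    (Category.assoc _ _ _).trans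
      ((congrArg (T.freeUnit (𝟙_ C) ≫ ·)
        (congrArg Monad.Algebra.Hom.f (unit_crossCounit Q))).trans T.η_counit)

/-- The morphism `T ⟶ Q ⋊ T` induced by the unit of `Q`. -/
def crossInl : T ⟶ cross Q :=
  { app := fun X => (Q.unitApp (T.freeMod X)).f
    naturality := fun X Y f =>
      congrArg Monad.Algebra.Hom.f (Q.unitApp_naturality (T.toMonad.free.map f))
    app_η := fun X => rfl
    app_μ := fun X => by
      have h : modCounit (T.freeMod X) ≫ Q.unitApp (T.freeMod X) =
          (T.toMonad.free.map (Q.unitApp (T.freeMod X)).f ≫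
            Q.unitApp (T.freeMod (Q.obj (T.freeMod X)).A)) ≫ crossProd Q X := by
        rw [Category.assoc, unit_crossProd, modCounit_naturality]
      exact congrArg Monad.Algebra.Hom.f h
    app_δ := fun X Y => congrArg Monad.Algebra.Hom.f (unit_crossδ Q X Y)
    app_counit := congrArg Monad.Algebra.Hom.f (unit_crossCounit Q) }

variable (C) in
/-- The identity bimonad `1_C`. -/
def ident : Bimonad C where
  toFunctor := 𝟭 C
  η := { app := fun X => 𝟙 X }
  μ := { app := fun X => 𝟙 X }
  oplax := (inferInstance : (𝟭 C).OplaxMonoidal)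
  μ_δ X Y := by simp
  μ_counit := by simp
  η_δ X Y := by simp
  η_counit := by simp

variable {Q}

/-- The component `e_M : Q M ⟶ M` of an augmentation `e` of `Q`. -/
def augApp (e : Q ⟶ ident T.Mod) (M : T.Mod) : Q.obj M ⟶ M := e.app M

/-- The morphism `Q ⋊ T ⟶ T` induced by an augmentation `e : Q ⟶ 1` of `Q`. -/
def crossPr (e : Q ⟶ ident T.Mod) : cross Q ⟶ T :=
  { app := fun X => (augApp e (T.freeMod X)).f
    naturality := fun X Y f => by
      have h : Q.map (T.toMonad.free.map f) ≫ augApp e (T.freeMod Y) =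
          augApp e (T.freeMod X) ≫ T.toMonad.free.map f := e.naturality _
      exact congrArg Monad.Algebra.Hom.f h
    app_η := fun X => by
      have h : Q.unitApp (T.freeMod X) ≫ augApp e (T.freeMod X) = 𝟙 _ := e.app_η (T.freeMod X)
      exact (Category.assoc _ _ _).trans ((congrArg (T.freeUnit X ≫ ·)
        (congrArg Monad.Algebra.Hom.f h)).trans (Category.comp_id _))
    app_μ := fun X => by
      have hn : ∀ {M N : T.Mod} (f : M ⟶ N), Q.map f ≫ augApp e N = augApp e M ≫ f :=
        fun f => e.naturality f
      have hμ : ∀ M : T.Mod, Q.prodApp M ≫ augApp e M = Q.map (augApp e M) ≫ augApp e M :=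
        fun M => (e.app_μ M).trans (Category.comp_id _)
      have h : crossProd Q X ≫ augApp e (T.freeMod X) =
          (Q.map (T.toMonad.free.map (augApp e (T.freeMod X)).f) ≫
            augApp e (T.freeMod (T.freeMod X).A)) ≫ modCounit (T.freeMod X) := by
        rw [Category.assoc, ← hn, ← Functor.map_comp_assoc, modCounit_naturality, crossProd,
          Category.assoc, hμ, Functor.map_comp, Category.assoc]
      exact congrArg Monad.Algebra.Hom.f h
    app_δ := fun X Y => by
      have hn : ∀ {M N : T.Mod} (f : M ⟶ N), Q.map f ≫ augApp e N = augApp e M ≫ f :=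
        fun f => e.naturality f
      have hδ : ∀ M N : T.Mod, δ Q.toFunctor M N ≫ (augApp e M ⊗ₘ augApp e N) =
          augApp e (M ⊗ N) :=
        fun M N => (e.app_δ M N).symm.trans (Category.comp_id _)
      have h : augApp e (T.freeMod (X ⊗ Y)) ≫ δ T.toMonad.free X Y =
          crossδ Q X Y ≫ (augApp e (T.freeMod X) ⊗ₘ augApp e (T.freeMod Y)) := by
        rw [crossδ, Category.assoc, hδ, hn]
      exact congrArg Monad.Algebra.Hom.f h
    app_counit := by
      have hn : ∀ {M N : T.Mod} (f : M ⟶ N), Q.map f ≫ augApp e N = augApp e M ≫ f :=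
        fun f => e.naturality f
      have hc : augApp e (𝟙_ T.Mod) = Functor.OplaxMonoidal.η Q.toFunctor :=
        (Category.comp_id _).symm.trans e.app_counit
      have h : augApp e (T.freeMod (𝟙_ C)) ≫ Functor.OplaxMonoidal.η T.toMonad.free =
          crossCounit Q := by
        rw [crossCounit, ← hc, hn]
      exact congrArg Monad.Algebra.Hom.f h }

end CrossProduct

/-! ### The bimonad represented by a central bialgebra -/

section Representable

variable {D : Type u} [Category.{v} D] [MonoidalCategory D]

section

variable (A : Center D)

/-- The half-braiding `σ_X : A ⊗ X ⟶ X ⊗ A` of an object `(A, σ)` of the center. -/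
def cBraid (X : D) : A.1 ⊗ X ⟶ X ⊗ A.1 := (A.2.β X).hom

theorem cBraid_naturality {X Y : D} (f : X ⟶ Y) :
    A.1 ◁ f ≫ cBraid A Y = cBraid A X ≫ f ▷ A.1 :=
  A.2.naturality f

theorem cBraid_tensor (X Y : D) :
    cBraid A (X ⊗ Y) = (α_ _ _ _).inv ≫ (cBraid A X ▷ Y) ≫ (α_ _ _ _).hom ≫
      (X ◁ cBraid A Y) ≫ (α_ _ _ _).inv :=
  A.2.monoidal X Y

theorem cBraid_unit : cBraid A (𝟙_ D) = (ρ_ A.1).hom ≫ (λ_ A.1).inv :=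
  (congrArg Center.Hom.f (braiding_tensorUnit_right A)).trans
    (congrArg ((ρ_ A.1).hom ≫ ·) (Center.leftUnitor_inv_f A))

variable [BimonObj A]

/-- The product `A ⊗ A ⟶ A` of a central bialgebra, as a morphism of the base category. -/
def cMul : A.1 ⊗ A.1 ⟶ A.1 := (MonObj.mul : A ⊗ A ⟶ A).f

/-- The unit `𝟙_ ⟶ A` of a central bialgebra, as a morphism of the base category. -/
def cOne : 𝟙_ D ⟶ A.1 := (MonObj.one : 𝟙_ (Center D) ⟶ A).f

/-- The coproduct `A ⟶ A ⊗ A` of a central bialgebra, as a morphism of the base category. -/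
def cComul : A.1 ⟶ A.1 ⊗ A.1 := (ComonObj.comul : A ⟶ A ⊗ A).f

/-- The counit `A ⟶ 𝟙_` of a central bialgebra, as a morphism of the base category. -/
def cCounit : A.1 ⟶ 𝟙_ D := (ComonObj.counit : A ⟶ 𝟙_ (Center D)).f

theorem cOne_cMul : cOne A ▷ A.1 ≫ cMul A = (λ_ A.1).hom :=
  congrArg Center.Hom.f (MonObj.one_mul A)

theorem cMul_cOne : A.1 ◁ cOne A ≫ cMul A = (ρ_ A.1).hom :=
  congrArg Center.Hom.f (MonObj.mul_one A)

theorem cMul_assoc :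
    cMul A ▷ A.1 ≫ cMul A = (α_ A.1 A.1 A.1).hom ≫ A.1 ◁ cMul A ≫ cMul A :=
  congrArg Center.Hom.f (MonObj.mul_assoc A)

theorem cCounit_cComul : cComul A ≫ cCounit A ▷ A.1 = (λ_ A.1).inv :=
  (congrArg Center.Hom.f (ComonObj.counit_comul A)).trans (Center.leftUnitor_inv_f A)

theorem cComul_cCounit : cComul A ≫ A.1 ◁ cCounit A = (ρ_ A.1).inv :=
  (congrArg Center.Hom.f (ComonObj.comul_counit A)).trans (Center.rightUnitor_inv_f A)

theorem cComul_assoc :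
    cComul A ≫ A.1 ◁ cComul A = cComul A ≫ cComul A ▷ A.1 ≫ (α_ A.1 A.1 A.1).hom :=
  congrArg Center.Hom.f (ComonObj.comul_assoc A)

theorem cMul_cBraid (X : D) :
    cMul A ▷ X ≫ cBraid A X =
      ((α_ _ _ _).hom ≫ A.1 ◁ cBraid A X ≫ (α_ _ _ _).inv ≫ cBraid A X ▷ A.1 ≫
        (α_ _ _ _).hom) ≫ X ◁ cMul A :=
  (MonObj.mul : A ⊗ A ⟶ A).comm X

theorem cOne_cBraid (X : D) :
    cOne A ▷ X ≫ cBraid A X = ((λ_ X).hom ≫ (ρ_ X).inv) ≫ X ◁ cOne A :=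
  (MonObj.one : 𝟙_ (Center D) ⟶ A).comm X

theorem cComul_cBraid (X : D) :
    cComul A ▷ X ≫ (α_ _ _ _).hom ≫ A.1 ◁ cBraid A X ≫ (α_ _ _ _).inv ≫
      cBraid A X ▷ A.1 ≫ (α_ _ _ _).hom = cBraid A X ≫ X ◁ cComul A :=
  (ComonObj.comul : A ⟶ A ⊗ A).comm X

theorem cCounit_cBraid (X : D) :
    cCounit A ▷ X ≫ (λ_ X).hom ≫ (ρ_ X).inv = cBraid A X ≫ X ◁ cCounit A :=
  (ComonObj.counit : A ⟶ 𝟙_ (Center D)).comm X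

theorem cMul_cComul :
    cMul A ≫ cComul A = (cComul A ⊗ₘ cComul A) ≫
      ((α_ _ _ _).hom ≫ (A.1 ◁ (α_ _ _ _).inv) ≫ (A.1 ◁ cBraid A A.1 ▷ A.1) ≫
        (A.1 ◁ (α_ _ _ _).hom) ≫ (α_ _ _ _).inv) ≫ (cMul A ⊗ₘ cMul A) := by
  have h := congrArg Center.Hom.f (BimonObj.mul_comul A)
  have e1 := Center.associator_inv_f A A A
  have e2 := Center.associator_inv_f A A (A ⊗ A)
  simp only [tensorμ, Center.comp_f, Center.whiskerLeft_f, e1, e2] at h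
  exact h

theorem cOne_cComul : cOne A ≫ cComul A = (λ_ (𝟙_ D)).inv ≫ (cOne A ⊗ₘ cOne A) := by
  have h := congrArg Center.Hom.f (BimonObj.one_comul A)
  have e := Center.leftUnitor_inv_f (𝟙_ (Center D))
  exact h.trans (congrArg (· ≫ (cOne A ⊗ₘ cOne A)) e)

theorem cMul_cCounit : cMul A ≫ cCounit A = (cCounit A ⊗ₘ cCounit A) ≫ (λ_ (𝟙_ D)).hom :=
  congrArg Center.Hom.f (BimonObj.mul_counit A)

theorem cOne_cCounit : cOne A ≫ cCounit A = 𝟙 (𝟙_ D) :=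
  congrArg Center.Hom.f (BimonObj.one_counit A)

/-- The comonoidal structure `(A ⊗ σ_X ⊗ Y)(Δ ⊗ X ⊗ Y)` of `A ⊗ ?`. -/
def repδ (X Y : D) : A.1 ⊗ (X ⊗ Y) ⟶ (A.1 ⊗ X) ⊗ (A.1 ⊗ Y) :=
  cComul A ▷ (X ⊗ Y) ≫ (α_ _ _ _).hom ≫ A.1 ◁ (α_ _ _ _).inv ≫ A.1 ◁ cBraid A X ▷ Y ≫
    A.1 ◁ (α_ _ _ _).hom ≫ (α_ _ _ _).inv

/-- The comonoidal endofunctor `A ⊗_σ ?`, with counit `ε`. -/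
@[reducible]
def repOplax : (tensorLeft A.1).OplaxMonoidal where
  δ X Y := repδ A X Y
  η := (ρ_ A.1).hom ≫ cCounit A
  δ_natural_left {X Y} f Z := by
    change repδ A X Z ≫ (A.1 ◁ f) ▷ (A.1 ⊗ Z) = A.1 ◁ (f ▷ Z) ≫ repδ A Y Z
    simp only [repδ]
    calc
      _ = 𝟙 _ ⊗≫ cComul A ▷ X ▷ Z ⊗≫ A.1 ◁ (cBraid A X ≫ f ▷ A.1) ▷ Z ⊗≫ 𝟙 _ := by monoidal
      _ = 𝟙 _ ⊗≫ (cComul A ▷ X ≫ (A.1 ⊗ A.1) ◁ f) ▷ Z ⊗≫ A.1 ◁ cBraid A Y ▷ Z ⊗≫ 𝟙 _ := by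
        rw [← cBraid_naturality]; monoidal
      _ = _ := by rw [← whisker_exchange]; monoidal
  δ_natural_right {X Y} Z f := by
    change repδ A Z X ≫ (A.1 ⊗ Z) ◁ (A.1 ◁ f) = A.1 ◁ (Z ◁ f) ≫ repδ A Z Y
    simp only [repδ]
    calc
      _ = 𝟙 _ ⊗≫ cComul A ▷ Z ▷ X ⊗≫ A.1 ◁ (cBraid A Z ▷ X ≫ (Z ⊗ A.1) ◁ f) ⊗≫ 𝟙 _ := by
        monoidal
      _ = 𝟙 _ ⊗≫ (cComul A ▷ (Z ⊗ X) ≫ (A.1 ⊗ A.1) ◁ (Z ◁ f)) ⊗≫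
          A.1 ◁ cBraid A Z ▷ Y ⊗≫ 𝟙 _ := by
        rw [← whisker_exchange]; monoidal
      _ = _ := by rw [← whisker_exchange]; monoidal
  oplax_associativity X Y Z := by
    change repδ A (X ⊗ Y) Z ≫ repδ A X Y ▷ (A.1 ⊗ Z) ≫ (α_ _ _ _).hom =
      A.1 ◁ (α_ X Y Z).hom ≫ repδ A X (Y ⊗ Z) ≫ (A.1 ⊗ X) ◁ repδ A Y Z
    simp only [repδ, cBraid_tensor]
    calc
      _ = 𝟙 _ ⊗≫ cComul A ▷ X ▷ Y ▷ Z ⊗≫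
          (A.1 ◁ (𝟙 (A.1 ⊗ (X ⊗ (Y ⊗ Z))) ⊗≫ cBraid A X ▷ Y ▷ Z ⊗≫ X ◁ cBraid A Y ▷ Z ⊗≫
              𝟙 (X ⊗ (Y ⊗ (A.1 ⊗ Z)))) ≫
            cComul A ▷ (X ⊗ (Y ⊗ (A.1 ⊗ Z)))) ⊗≫
          A.1 ◁ cBraid A X ▷ Y ▷ A.1 ▷ Z ⊗≫ 𝟙 _ := by monoidal
      _ = 𝟙 _ ⊗≫ (cComul A ≫ cComul A ▷ A.1 ≫ (α_ A.1 A.1 A.1).hom) ▷ X ▷ Y ▷ Z ⊗≫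
          A.1 ◁ A.1 ◁ cBraid A X ▷ Y ▷ Z ⊗≫
          A.1 ◁ ((A.1 ⊗ X) ◁ (cBraid A Y ▷ Z) ≫ cBraid A X ▷ ((Y ⊗ A.1) ⊗ Z)) ⊗≫ 𝟙 _ := by
        rw [whisker_exchange]; monoidal
      _ = 𝟙 _ ⊗≫ cComul A ▷ X ▷ Y ▷ Z ⊗≫
          A.1 ◁ (cComul A ▷ X ≫ (α_ A.1 A.1 X).hom ≫ A.1 ◁ cBraid A X ≫ (α_ A.1 X A.1).inv ≫
            cBraid A X ▷ A.1 ≫ (α_ X A.1 A.1).hom) ▷ Y ▷ Z ⊗≫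
          A.1 ◁ X ◁ A.1 ◁ cBraid A Y ▷ Z ⊗≫ 𝟙 _ := by
        rw [whisker_exchange, ← cComul_assoc]; monoidal
      _ = _ := by rw [cComul_cBraid]; monoidal
  oplax_left_unitality X := by
    change (λ_ (A.1 ⊗ X)).inv = A.1 ◁ (λ_ X).inv ≫ repδ A (𝟙_ D) X ≫
      ((ρ_ A.1).hom ≫ cCounit A) ▷ (A.1 ⊗ X)
    simp only [repδ, cBraid_unit]
    symm
    calc
      _ = 𝟙 _ ⊗≫ (cComul A ≫ cCounit A ▷ A.1) ▷ X ⊗≫ 𝟙 _ := by monoidal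
      _ = _ := by rw [cCounit_cComul]; monoidal
  oplax_right_unitality X := by
    change (ρ_ (A.1 ⊗ X)).inv = A.1 ◁ (ρ_ X).inv ≫ repδ A X (𝟙_ D) ≫
      (A.1 ⊗ X) ◁ ((ρ_ A.1).hom ≫ cCounit A)
    simp only [repδ]
    symm
    calc
      _ = 𝟙 _ ⊗≫ cComul A ▷ X ⊗≫ A.1 ◁ (cBraid A X ≫ X ◁ cCounit A) ⊗≫ 𝟙 _ := by monoidal
      _ = 𝟙 _ ⊗≫ (cComul A ≫ A.1 ◁ cCounit A) ▷ X ⊗≫ 𝟙 _ := by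
        rw [← cCounit_cBraid]; monoidal
      _ = _ := by rw [cComul_cCounit]; monoidal

/-- The monad `A ⊗ ?`, with product `m ⊗ X` and unit `u ⊗ X`. -/
def repMonad : Monad D where
  toFunctor := tensorLeft A.1
  η :=
    { app := fun X => (λ_ X).inv ≫ cOne A ▷ X
      naturality := fun X Y f => by
        change f ≫ (λ_ Y).inv ≫ cOne A ▷ Y = ((λ_ X).inv ≫ cOne A ▷ X) ≫ A.1 ◁ f
        rw [Category.assoc, ← whisker_exchange]
        simp }
  μ :=
    { app := fun X => (α_ A.1 A.1 X).inv ≫ cMul A ▷ X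
      naturality := fun X Y f => by
        change A.1 ◁ A.1 ◁ f ≫ (α_ A.1 A.1 Y).inv ≫ cMul A ▷ Y =
          ((α_ A.1 A.1 X).inv ≫ cMul A ▷ X) ≫ A.1 ◁ f
        rw [Category.assoc, ← whisker_exchange]
        simp }
  assoc X := by
    change A.1 ◁ ((α_ A.1 A.1 X).inv ≫ cMul A ▷ X) ≫ (α_ A.1 A.1 X).inv ≫ cMul A ▷ X =
      ((α_ A.1 A.1 (A.1 ⊗ X)).inv ≫ cMul A ▷ (A.1 ⊗ X)) ≫ (α_ A.1 A.1 X).inv ≫ cMul A ▷ X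
    symm
    calc
      _ = 𝟙 _ ⊗≫ (cMul A ▷ A.1 ≫ cMul A) ▷ X ⊗≫ 𝟙 _ := by monoidal
      _ = _ := by rw [cMul_assoc]; monoidal
  left_unit X := by
    change ((λ_ (A.1 ⊗ X)).inv ≫ cOne A ▷ (A.1 ⊗ X)) ≫ (α_ A.1 A.1 X).inv ≫ cMul A ▷ X =
      𝟙 (A.1 ⊗ X)
    calc
      _ = 𝟙 _ ⊗≫ (cOne A ▷ A.1 ≫ cMul A) ▷ X ⊗≫ 𝟙 _ := by monoidal
      _ = _ := by rw [cOne_cMul]; monoidal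
  right_unit X := by
    change A.1 ◁ ((λ_ X).inv ≫ cOne A ▷ X) ≫ (α_ A.1 A.1 X).inv ≫ cMul A ▷ X = 𝟙 (A.1 ⊗ X)
    calc
      _ = 𝟙 _ ⊗≫ (A.1 ◁ cOne A ≫ cMul A) ▷ X ⊗≫ 𝟙 _ := by monoidal
      _ = _ := by rw [cMul_cOne]; monoidal

theorem rep_μ_δ (X Y : D) :
    ((α_ A.1 A.1 (X ⊗ Y)).inv ≫ cMul A ▷ (X ⊗ Y)) ≫ repδ A X Y =
      A.1 ◁ repδ A X Y ≫ repδ A (A.1 ⊗ X) (A.1 ⊗ Y) ≫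
        (((α_ A.1 A.1 X).inv ≫ cMul A ▷ X) ⊗ₘ ((α_ A.1 A.1 Y).inv ≫ cMul A ▷ Y)) := by
  simp only [repδ, cBraid_tensor]
  calc
    _ = 𝟙 _ ⊗≫ (cMul A ≫ cComul A) ▷ X ▷ Y ⊗≫ A.1 ◁ cBraid A X ▷ Y ⊗≫ 𝟙 _ := by monoidal
    _ = 𝟙 _ ⊗≫ cComul A ▷ A.1 ▷ X ▷ Y ⊗≫ A.1 ◁ A.1 ◁ cComul A ▷ X ▷ Y ⊗≫
        A.1 ◁ cBraid A A.1 ▷ A.1 ▷ X ▷ Y ⊗≫ cMul A ▷ A.1 ▷ A.1 ▷ X ▷ Y ⊗≫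
        A.1 ◁ (cMul A ▷ X ≫ cBraid A X) ▷ Y ⊗≫ 𝟙 _ := by
      rw [cMul_cComul, MonoidalCategory.tensorHom_def, MonoidalCategory.tensorHom_def]; monoidal
    _ = 𝟙 _ ⊗≫ cComul A ▷ A.1 ▷ X ▷ Y ⊗≫ A.1 ◁ A.1 ◁ cComul A ▷ X ▷ Y ⊗≫
        A.1 ◁ cBraid A A.1 ▷ A.1 ▷ X ▷ Y ⊗≫
        (cMul A ▷ (A.1 ⊗ (A.1 ⊗ (X ⊗ Y))) ≫
          A.1 ◁ (𝟙 (A.1 ⊗ (A.1 ⊗ (X ⊗ Y))) ⊗≫ A.1 ◁ cBraid A X ▷ Y ⊗≫ cBraid A X ▷ A.1 ▷ Y ⊗≫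
            𝟙 (X ⊗ (A.1 ⊗ (A.1 ⊗ Y))))) ⊗≫
        A.1 ◁ X ◁ cMul A ▷ Y ⊗≫ 𝟙 _ := by
      rw [cMul_cBraid]; monoidal
    _ = 𝟙 _ ⊗≫ cComul A ▷ A.1 ▷ X ▷ Y ⊗≫ A.1 ◁ A.1 ◁ cComul A ▷ X ▷ Y ⊗≫
        A.1 ◁ (cBraid A A.1 ▷ ((A.1 ⊗ X) ⊗ Y) ≫ (A.1 ⊗ A.1) ◁ (cBraid A X ▷ Y)) ⊗≫
        A.1 ◁ A.1 ◁ cBraid A X ▷ A.1 ▷ Y ⊗≫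
        cMul A ▷ X ▷ A.1 ▷ A.1 ▷ Y ⊗≫ A.1 ◁ X ◁ cMul A ▷ Y ⊗≫ 𝟙 _ := by
      rw [← whisker_exchange]; monoidal
    _ = 𝟙 _ ⊗≫ (cComul A ▷ (A.1 ⊗ (X ⊗ Y)) ≫
          (A.1 ⊗ A.1) ◁ (cComul A ▷ (X ⊗ Y) ⊗≫ A.1 ◁ cBraid A X ▷ Y ⊗≫
            𝟙 (A.1 ⊗ (X ⊗ (A.1 ⊗ Y))))) ⊗≫
        A.1 ◁ cBraid A A.1 ▷ X ▷ A.1 ▷ Y ⊗≫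
        A.1 ◁ A.1 ◁ cBraid A X ▷ A.1 ▷ Y ⊗≫
        cMul A ▷ X ▷ A.1 ▷ A.1 ▷ Y ⊗≫ A.1 ◁ X ◁ cMul A ▷ Y ⊗≫ 𝟙 _ := by
      rw [← whisker_exchange]; monoidal
    _ = _ := by
      rw [← whisker_exchange, MonoidalCategory.tensorHom_def]; monoidal

/-- The bimonad `A ⊗_σ ?` on `D` represented by a bialgebra `(A, σ)` in the center of `D`. -/
def rep : Bimonad D where
  toMonad := repMonad A
  oplax := repOplax A
  μ_δ X Y := rep_μ_δ A X Y
  μ_counit := by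
    change ((α_ A.1 A.1 (𝟙_ D)).inv ≫ cMul A ▷ (𝟙_ D)) ≫ (ρ_ A.1).hom ≫ cCounit A =
      A.1 ◁ ((ρ_ A.1).hom ≫ cCounit A) ≫ (ρ_ A.1).hom ≫ cCounit A
    calc
      _ = 𝟙 _ ⊗≫ (cMul A ≫ cCounit A) := by monoidal
      _ = _ := by
        rw [cMul_cCounit, MonoidalCategory.tensorHom_def']; monoidal
  η_δ X Y := by
    change ((λ_ (X ⊗ Y)).inv ≫ cOne A ▷ (X ⊗ Y)) ≫ repδ A X Y =
      ((λ_ X).inv ≫ cOne A ▷ X) ⊗ₘ ((λ_ Y).inv ≫ cOne A ▷ Y)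
    simp only [repδ]
    calc
      _ = 𝟙 _ ⊗≫ (cOne A ≫ cComul A) ▷ X ▷ Y ⊗≫ A.1 ◁ cBraid A X ▷ Y ⊗≫ 𝟙 _ := by monoidal
      _ = 𝟙 _ ⊗≫ cOne A ▷ X ▷ Y ⊗≫ A.1 ◁ (cOne A ▷ X ≫ cBraid A X) ▷ Y ⊗≫ 𝟙 _ := by
        rw [cOne_cComul, MonoidalCategory.tensorHom_def]; monoidal
      _ = _ := by
        rw [cOne_cBraid, MonoidalCategory.tensorHom_def]; monoidal
  η_counit := by
    change ((λ_ (𝟙_ D)).inv ≫ cOne A ▷ (𝟙_ D)) ≫ (ρ_ A.1).hom ≫ cCounit A = 𝟙 (𝟙_ D)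
    calc
      _ = 𝟙 _ ⊗≫ (cOne A ≫ cCounit A) := by monoidal
      _ = _ := by rw [cOne_cCounit]; monoidal

/-- The augmentation `ε ⊗ ? : A ⊗_σ ? ⟶ 1` of the bimonad represented by `(A, σ)`. -/
def repAug : rep A ⟶ ident D :=
  { app := fun X => cCounit A ▷ X ≫ (λ_ X).hom
    naturality := fun X Y f => by
      change A.1 ◁ f ≫ cCounit A ▷ Y ≫ (λ_ Y).hom = (cCounit A ▷ X ≫ (λ_ X).hom) ≫ f
      rw [whisker_exchange_assoc]
      simp
    app_η := fun X => by
      change ((λ_ X).inv ≫ cOne A ▷ X) ≫ cCounit A ▷ X ≫ (λ_ X).hom = 𝟙 X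
      calc
        _ = 𝟙 _ ⊗≫ (cOne A ≫ cCounit A) ▷ X ⊗≫ 𝟙 _ := by monoidal
        _ = _ := by rw [cOne_cCounit]; monoidal
    app_μ := fun X => by
      change ((α_ A.1 A.1 X).inv ≫ cMul A ▷ X) ≫ cCounit A ▷ X ≫ (λ_ X).hom =
        (A.1 ◁ (cCounit A ▷ X ≫ (λ_ X).hom) ≫ cCounit A ▷ X ≫ (λ_ X).hom) ≫ 𝟙 X
      calc
        _ = 𝟙 _ ⊗≫ (cMul A ≫ cCounit A) ▷ X ⊗≫ 𝟙 _ := by monoidal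
        _ = _ := by rw [cMul_cCounit, MonoidalCategory.tensorHom_def']; monoidal
    app_δ := fun X Y => by
      change (cCounit A ▷ (X ⊗ Y) ≫ (λ_ (X ⊗ Y)).hom) ≫ 𝟙 (X ⊗ Y) =
        repδ A X Y ≫ ((cCounit A ▷ X ≫ (λ_ X).hom) ⊗ₘ (cCounit A ▷ Y ≫ (λ_ Y).hom))
      symm
      simp only [repδ]
      calc
        _ = 𝟙 _ ⊗≫ cComul A ▷ X ▷ Y ⊗≫ A.1 ◁ (cBraid A X ≫ X ◁ cCounit A) ▷ Y ⊗≫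
            cCounit A ▷ X ▷ Y ⊗≫ 𝟙 _ := by
          rw [MonoidalCategory.tensorHom_def']; monoidal
        _ = 𝟙 _ ⊗≫ (cComul A ≫ A.1 ◁ cCounit A) ▷ X ▷ Y ⊗≫ cCounit A ▷ X ▷ Y ⊗≫ 𝟙 _ := by
          rw [← cCounit_cBraid]; monoidal
        _ = _ := by rw [cComul_cCounit]; monoidal
    app_counit := by
      change (cCounit A ▷ (𝟙_ D) ≫ (λ_ (𝟙_ D)).hom) ≫ 𝟙 (𝟙_ D) = (ρ_ A.1).hom ≫ cCounit A
      monoidal }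

end

end Representable

/-! ### The cross product `A ⋊_σ T` -/

section Bosonization

variable (T : Bimonad C) (A : Center T.Mod) [BimonObj A]

/-- The cross product `A ⋊_σ T = (A ⊗_σ ?) ⋊ T` of a bimonad `T` by a bialgebra `(A, σ)` in the
center of the category of `T`-modules. -/
def boson : Bimonad C := cross (rep A)

/-- The canonical morphism `ι = u ⊗ T : T ⟶ A ⋊_σ T`. -/
def bosonInl : T ⟶ boson T A := crossInl (rep A)

/-- The canonical morphism `π = ε ⊗ T : A ⋊_σ T ⟶ T`. -/
def bosonPr : boson T A ⟶ T := crossPr (repAug A)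

end Bosonization

end Bimonad

end CategoryTheory

open CategoryTheory MonoidalCategory Limits

/-! The argument is the analogue for Hopf monads of Radford's theorem on Hopf algebras with a
projection. Write `f^*` and `g^*` for restriction of modules along `f : T ⟶ P` and `g : P ⟶ T`;
since `g f = 1`, the composite `f^* g^*` is the identity, so every `T`-module `M` is canonically the
restriction of a `P`-module `g^* M`.

The candidate for the Hopf algebra is the `P`-module `B` induced from the unit `T`-module, that is,
the coequalizer of `P T₀` and `μ_𝟙 P(f_𝟙)` on `P 𝟙`, with its canonical element `u : 𝟙 ⟶ B`. The
Hopf property yields a projection formula: `B ⊗ N` and `N ⊗ B` are both induced from `f^* N`.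
Concretely, `P`-linear maps `B ⊗ N ⟶ N'` correspond, by restriction along `u ⊗ N`, to `T`-linear
maps `f^* N ⟶ f^* N'`, and likewise on the other side. This is recorded by `InducedUnit` and proved
by `exists_left_of_coequalizer`, `left_ext_of_coequalizer` and their mirror images, which rest on
the invertibility of fusion with an arbitrary module (`isIso_modLeftFusion`,
`isIso_modRightFusion`).

Everything else is formal. The product is the `P`-linear map `B ⊗ g^* f^* B ⟶ B` extending the
identity; the coproduct extends `u ⊗ u`; the counit extends the identity of `𝟙`; the half-braiding
`B ⊗ g^* M ⟶ g^* M ⊗ B` extends `M ⊗ u`, and its inverse comes from the universal property on the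
other side. The antipode comes from the division map `B ⊗ B ⟶ g^* f^* B` extending the identity.
Each axiom compares two `P`-linear maps out of some `B ⊗ N`, and is checked on `u ⊗ N`.

Finally `P X` is the free `P`-module on `X`, while `B ⊗ g^* (T X)` is the `P`-module induced from
the free `T`-module on `X`. Both have the same universal property, which gives the isomorphism `P X
≅ B ⊗ T X`; its compatibility with the structures is checked on generators by `Lin.free_ext`. -/

namespace CategoryTheory

/-! ### Coequalizers of reflexive pairs -/

/-- `q` is a coequalizer of the reflexive pair `d₀, d₁`. -/
structure IsReflexiveCoequalizer {C : Type u} [Category.{v} C] {X Y Z : C} (d₀ d₁ : X ⟶ Y)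
    (q : Y ⟶ Z) : Prop where
  isReflexivePair : IsReflexivePair d₀ d₁
  condition : d₀ ≫ q = d₁ ≫ q
  nonempty_isColimit : Nonempty (IsColimit (Cofork.ofπ q condition))

namespace IsReflexiveCoequalizer

variable {C : Type u} [Category.{v} C] {X Y Z : C} {d₀ d₁ : X ⟶ Y} {q : Y ⟶ Z}

theorem epi (h : IsReflexiveCoequalizer d₀ d₁ q) : Epi q :=
  epi_of_isColimit_cofork h.nonempty_isColimit.some

theorem exists_desc (h : IsReflexiveCoequalizer d₀ d₁ q) {W : C} (k : Y ⟶ W)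
    (hk : d₀ ≫ k = d₁ ≫ k) : ∃ l : Z ⟶ W, q ≫ l = k :=
  ⟨_, (Cofork.IsColimit.desc' h.nonempty_isColimit.some k hk).2⟩

/-- A functor carries a common section to a common section, so the image is again a reflexive
coequalizer and preservation can be iterated, as is needed for `P P q`. -/
theorem map (h : IsReflexiveCoequalizer d₀ d₁ q) {D : Type u} [Category.{v} D] (G : C ⥤ D)
    (hG : Monad.PreservesColimitOfIsReflexivePair G) :
    IsReflexiveCoequalizer (G.map d₀) (G.map d₁) (G.map q) := by
  have := h.isReflexivePair
  have := hG.out d₀ d₁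
  obtain ⟨s, h0, h1⟩ := h.isReflexivePair.common_section'
  exact
    { isReflexivePair := ⟨⟨G.map s, by rw [← G.map_comp, h0, G.map_id],
        by rw [← G.map_comp, h1, G.map_id]⟩⟩
      condition := by rw [← G.map_comp, ← G.map_comp, h.condition]
      nonempty_isColimit :=
        ⟨isColimitCoforkMapOfIsColimit G h.condition h.nonempty_isColimit.some⟩ }

end IsReflexiveCoequalizer

theorem exists_isReflexiveCoequalizer {C : Type u} [Category.{v} C] [HasReflexiveCoequalizers C]
    {X Y : C} (d₀ d₁ : X ⟶ Y) (h : IsReflexivePair d₀ d₁) :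
    ∃ (Z : C) (q : Y ⟶ Z), IsReflexiveCoequalizer d₀ d₁ q :=
  ⟨_, coequalizer.π d₀ d₁, h, coequalizer.condition d₀ d₁, ⟨coequalizerIsCoequalizer d₀ d₁⟩⟩

end CategoryTheory

namespace CategoryTheory.Bimonad

open CategoryTheory.Functor.OplaxMonoidal (δ δ_natural δ_natural_left δ_natural_right)

variable {C : Type u} [Category.{v} C] [MonoidalCategory C]

/-! ### Linear morphisms between objects carrying an action of a bimonad -/

/-- The unit `T₀ : T 𝟙_ ⟶ 𝟙_` of the comonoidal structure, the action of `T` on `𝟙_`. -/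
abbrev unitAct (T : Bimonad C) : T.obj (𝟙_ C) ⟶ 𝟙_ C := Functor.OplaxMonoidal.η T.toFunctor

/-- A morphism `h` is linear for the actions `a` and `b` of `T`. -/
def Lin (T : Bimonad C) {X Y : C} (a : T.obj X ⟶ X) (b : T.obj Y ⟶ Y) (h : X ⟶ Y) : Prop :=
  T.map h ≫ b = a ≫ h

/-- The diagonal action of a bimonad on a tensor product. -/
def tens (T : Bimonad C) {X Y : C} (a : T.obj X ⟶ X) (b : T.obj Y ⟶ Y) :
    T.obj (X ⊗ Y) ⟶ X ⊗ Y :=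
  δ T.toFunctor X Y ≫ (a ⊗ₘ b)

namespace Lin

variable {T : Bimonad C} {X Y Z W : C} {a : T.obj X ⟶ X} {b : T.obj Y ⟶ Y} {c : T.obj Z ⟶ Z}
  {d : T.obj W ⟶ W}

/-- Linearity refers to bare morphisms `a`, `b` and uses no module axiom. The lemmas below then form
a calculus in which the linearity of a composite is proved by a term of the same shape as the
composite. -/
theorem id (a : T.obj X ⟶ X) : Lin T a a (𝟙 X) := by simp [Lin]

theorem comp {h : X ⟶ Y} {k : Y ⟶ Z} (hh : Lin T a b h) (hk : Lin T b c k) :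
    Lin T a c (h ≫ k) := by
  unfold Lin at *
  rw [Functor.map_comp, Category.assoc, hk, reassoc_of% hh]

theorem tensor {h : X ⟶ Y} {k : Z ⟶ W} (hh : Lin T a b h) (hk : Lin T c d k) :
    Lin T (T.tens a c) (T.tens b d) (h ⊗ₘ k) := by
  unfold Lin tens at *
  rw [← reassoc_of% δ_natural, tensorHom_comp_tensorHom, hh, hk, Category.assoc,
    tensorHom_comp_tensorHom]

theorem whiskerLeft (a : T.obj X ⟶ X) {h : Y ⟶ Z} (hh : Lin T b c h) :
    Lin T (T.tens a b) (T.tens a c) (X ◁ h) := by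
  simpa using (Lin.id a).tensor hh

theorem whiskerRight {h : X ⟶ Y} (hh : Lin T a b h) (c : T.obj Z ⟶ Z) :
    Lin T (T.tens a c) (T.tens b c) (h ▷ Z) := by
  simpa using hh.tensor (Lin.id c)

theorem inv {h : X ⟶ Y} {k : Y ⟶ X} (hh : Lin T a b h) (h1 : h ≫ k = 𝟙 X) (h2 : k ≫ h = 𝟙 Y) :
    Lin T b a k := by
  unfold Lin at *
  have : IsIso h := ⟨k, h1, h2⟩
  rw [← cancel_mono h, Category.assoc, Category.assoc, ← hh, h2, ← Functor.map_comp_assoc, h2]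
  simp

theorem assoc (a : T.obj X ⟶ X) (b : T.obj Y ⟶ Y) (c : T.obj Z ⟶ Z) :
    Lin T (T.tens (T.tens a b) c) (T.tens a (T.tens b c)) (α_ X Y Z).hom := by
  have h := Functor.OplaxMonoidal.oplax_associativity T.toFunctor X Y Z
  unfold Lin tens
  have h1 : (a ⊗ₘ (δ T.toFunctor Y Z ≫ (b ⊗ₘ c))) =
      T.obj X ◁ δ T.toFunctor Y Z ≫ (a ⊗ₘ (b ⊗ₘ c)) := by
    rw [← id_tensorHom, tensorHom_comp_tensorHom, Category.id_comp]
  have h2 : ((δ T.toFunctor X Y ≫ (a ⊗ₘ b)) ⊗ₘ c) =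
      δ T.toFunctor X Y ▷ T.obj Z ≫ ((a ⊗ₘ b) ⊗ₘ c) := by
    rw [← tensorHom_id, tensorHom_comp_tensorHom, Category.id_comp]
  rw [h1, h2]
  simp only [Category.assoc, associator_naturality]
  rw [reassoc_of% h]

theorem assoc_inv (a : T.obj X ⟶ X) (b : T.obj Y ⟶ Y) (c : T.obj Z ⟶ Z) :
    Lin T (T.tens a (T.tens b c)) (T.tens (T.tens a b) c) (α_ X Y Z).inv :=
  (assoc a b c).inv (by simp) (by simp)

theorem leftUnitor (a : T.obj X ⟶ X) : Lin T (T.tens T.unitAct a) a (λ_ X).hom := by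
  have h := Functor.OplaxMonoidal.left_unitality_hom T.toFunctor X
  unfold Lin tens
  rw [← h, MonoidalCategory.tensorHom_def]
  simp

theorem leftUnitor_inv (a : T.obj X ⟶ X) : Lin T a (T.tens T.unitAct a) (λ_ X).inv :=
  (leftUnitor a).inv (by simp) (by simp)

theorem rightUnitor (a : T.obj X ⟶ X) : Lin T (T.tens a T.unitAct) a (ρ_ X).hom := by
  have h := Functor.OplaxMonoidal.right_unitality_hom T.toFunctor X
  unfold Lin tens
  rw [← h, MonoidalCategory.tensorHom_def']
  simp

theorem rightUnitor_inv (a : T.obj X ⟶ X) : Lin T a (T.tens a T.unitAct) (ρ_ X).inv :=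
  (rightUnitor a).inv (by simp) (by simp)

/-- Linear morphisms out of a free module are determined by their restriction along the unit. -/
theorem free_ext {h k : T.obj X ⟶ Y} (hh : Lin T (T.prodApp X) b h) (hk : Lin T (T.prodApp X) b k)
    (e : T.unitApp X ≫ h = T.unitApp X ≫ k) : h = k := by
  unfold Lin at hh hk
  -- By linearity, `h` equals `T(η) μ h = T(η h) b`, which depends only on `η h`; the same holds for
  -- `k`.
  rw [← Category.id_comp h, ← Category.id_comp k, ← map_unitApp_prodApp, Category.assoc,
    Category.assoc, ← hh, ← hk, ← Functor.map_comp_assoc, ← Functor.map_comp_assoc, e]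

theorem free_map (h : X ⟶ Y) : Lin T (T.prodApp X) (T.prodApp Y) (T.map h) :=
  T.prodApp_naturality h

theorem mod_hom {M N : T.Mod} (h : M ⟶ N) : Lin T M.a N.a h.f := h.h

theorem action (M : T.Mod) : Lin T (T.prodApp M.A) M.a M.a := M.assoc.symm

/-- The linear extension of a morphism to the free module on its source. -/
theorem extend (N : T.Mod) (h : X ⟶ N.A) : Lin T (T.prodApp X) N.a (T.map h ≫ N.a) :=
  (free_map h).comp (action N)

end Lin

theorem unitApp_extend {T : Bimonad C} (N : T.Mod) {X : C} (h : X ⟶ N.A) :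
    T.unitApp X ≫ T.map h ≫ N.a = h := by
  rw [← reassoc_of% T.unitApp_naturality]
  exact (congrArg (h ≫ ·) N.unit).trans (Category.comp_id h)

theorem unit_act {T : Bimonad C} (N : T.Mod) : T.unitApp N.A ≫ N.a = 𝟙 N.A := N.unit

/-! ### Restriction along a morphism of bimonads -/

section Pull

variable {T P : Bimonad C} (f : T ⟶ P)

/-- The action of `T` obtained from an action of `P` along a morphism `T ⟶ P`. -/
def pull {X : C} (a : P.obj X ⟶ X) : T.obj X ⟶ X := f.app X ≫ a

theorem unitApp_app (X : C) : T.unitApp X ≫ f.app X = P.unitApp X := f.app_η X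

theorem prodApp_app (X : C) :
    T.prodApp X ≫ f.app X = f.app (T.obj X) ≫ P.map (f.app X) ≫ P.prodApp X := by
  have h := f.app_μ X
  have h2 := f.naturality (f.app X)
  rw [prodApp, prodApp, h, ← reassoc_of% h2]
  simp only [Category.assoc]

theorem app_naturality {X Y : C} (h : X ⟶ Y) : T.map h ≫ f.app Y = f.app X ≫ P.map h :=
  f.naturality h

theorem pull_tens {X Y : C} (a : P.obj X ⟶ X) (b : P.obj Y ⟶ Y) :
    pull f (P.tens a b) = T.tens (pull f a) (pull f b) := by
  have h := f.app_δ X Y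
  unfold pull tens
  rw [reassoc_of% h, tensorHom_comp_tensorHom]

theorem pull_unitAct : pull f P.unitAct = T.unitAct := f.app_counit

/-- This is how the retraction enters: a `T`-action survives unchanged when it is made a `P`-action
through `g` and restricted back along `f`. -/
theorem pull_pull {f : T ⟶ P} {g : P ⟶ T} (h : f ≫ g = 𝟙 T) {X : C} (a : T.obj X ⟶ X) :
    pull f (pull g a) = a := by
  have h1 : f.app X ≫ g.app X = 𝟙 _ := by rw [← comp_app, h, id_app]
  unfold pull
  rw [reassoc_of% h1]

/-- The restriction of a `P`-module along a morphism `T ⟶ P`. -/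
def res (N : P.Mod) : T.Mod where
  A := N.A
  a := pull f N.a
  unit := (Category.assoc _ _ _).symm.trans ((congrArg (· ≫ N.a) (f.app_η N.A)).trans N.unit)
  assoc := by
    have h1 := prodApp_app f N.A
    have h2 := N.assoc
    have h3 := f.naturality N.a
    change T.prodApp N.A ≫ f.app N.A ≫ N.a = T.map (f.app N.A ≫ N.a) ≫ f.app N.A ≫ N.a
    change P.prodApp N.A ≫ N.a = _ at h2
    rw [reassoc_of% h1, h2, Functor.map_comp, Category.assoc, reassoc_of% h3,
      ← reassoc_of% (f.naturality (f.app N.A))]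

theorem Lin.pull {f : T ⟶ P} {X Y : C} {a : P.obj X ⟶ X} {b : P.obj Y ⟶ Y} {h : X ⟶ Y}
    (hh : Lin P a b h) : Lin T (pull f a) (pull f b) h := by
  unfold Lin Bimonad.pull at *
  rw [Category.assoc, ← hh, ← reassoc_of% (app_naturality f)]

end Pull

/-! ### Fusion isomorphisms for modules -/

section Fusion

variable {P : Bimonad C}

/-- The left fusion morphism `P (X ⊗ N) ⟶ P X ⊗ N` of an object `X` and a `P`-module `N`. -/
def modLeftFusion (X : C) (N : P.Mod) : P.obj (X ⊗ N.A) ⟶ P.obj X ⊗ N.A :=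
  δ P.toFunctor X N.A ≫ P.obj X ◁ N.a

/-- The right fusion morphism `P (N ⊗ X) ⟶ N ⊗ P X` of an object `X` and a `P`-module `N`. -/
def modRightFusion (N : P.Mod) (X : C) : P.obj (N.A ⊗ X) ⟶ N.A ⊗ P.obj X :=
  δ P.toFunctor N.A X ≫ N.a ▷ P.obj X

theorem unitApp_modLeftFusion (X : C) (N : P.Mod) :
    P.unitApp (X ⊗ N.A) ≫ modLeftFusion X N = P.unitApp X ▷ N.A := by
  rw [modLeftFusion, reassoc_of% P.unitApp_δ, MonoidalCategory.tensorHom_def, Category.assoc,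
    ← MonoidalCategory.whiskerLeft_comp, unit_act]
  simp

theorem unitApp_modRightFusion (X : C) (N : P.Mod) :
    P.unitApp (N.A ⊗ X) ≫ modRightFusion N X = N.A ◁ P.unitApp X := by
  rw [modRightFusion, reassoc_of% P.unitApp_δ, MonoidalCategory.tensorHom_def', Category.assoc,
    ← comp_whiskerRight, unit_act]
  simp

/-- Together with its value on the unit, this characterizes the fusion morphism as the linear
extension of `η_X ⊗ N` to the free module on `X ⊗ N`. Once invertible, it shows that `P X ⊗ N` is
free on `X ⊗ N`. -/
theorem lin_modLeftFusion (X : C) (N : P.Mod) :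
    Lin P (P.prodApp (X ⊗ N.A)) (P.tens (P.prodApp X) N.a) (modLeftFusion X N) := by
  have h := P.prodApp_δ X N.A
  have hN : P.map N.a ≫ N.a = P.prodApp N.A ≫ N.a := N.assoc.symm
  unfold Lin tens modLeftFusion
  rw [reassoc_of% h, Functor.map_comp, Category.assoc, ← reassoc_of% δ_natural_right]
  rw [← id_tensorHom, ← id_tensorHom, tensorHom_comp_tensorHom, tensorHom_comp_tensorHom, hN]
  simp

theorem lin_modRightFusion (X : C) (N : P.Mod) :
    Lin P (P.prodApp (N.A ⊗ X)) (P.tens N.a (P.prodApp X)) (modRightFusion N X) := by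
  have h := P.prodApp_δ N.A X
  have hN : P.map N.a ≫ N.a = P.prodApp N.A ≫ N.a := N.assoc.symm
  unfold Lin tens modRightFusion
  rw [reassoc_of% h, Functor.map_comp, Category.assoc, ← reassoc_of% δ_natural_left]
  rw [← tensorHom_id, ← tensorHom_id, tensorHom_comp_tensorHom, tensorHom_comp_tensorHom, hN]
  simp

/-- For a free module this is the fusion operator `H^l`. A general module is a quotient of the free
module on its underlying object, split in `C` by the unit, and invertibility passes to such a
quotient. -/
theorem isIso_modLeftFusion (hP : P.IsHopf) (X : C) (N : P.Mod) :
    IsIso (modLeftFusion X N) := by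
  have hH (Y : C) : IsIso (P.leftFusion X Y) := hP.isIso_leftFusion X Y
  have hN : P.map N.a ≫ N.a = P.prodApp N.A ≫ N.a := N.assoc.symm
  have act : P.map (X ◁ N.a) ≫ modLeftFusion X N =
      P.leftFusion X N.A ≫ P.obj X ◁ N.a := by
    unfold modLeftFusion leftFusion
    rw [← reassoc_of% δ_natural_right, Category.assoc, ← MonoidalCategory.whiskerLeft_comp, hN,
      MonoidalCategory.whiskerLeft_comp]
    rfl
  have nat {Y Z : C} (h : Y ⟶ Z) : P.map (X ◁ P.map h) ≫ P.leftFusion X Z =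
      P.leftFusion X Y ≫ P.obj X ◁ P.map h := by
    unfold leftFusion
    rw [← reassoc_of% δ_natural_right, Category.assoc, ← MonoidalCategory.whiskerLeft_comp,
      ← MonoidalCategory.whiskerLeft_comp]
    exact congrArg (fun t => δ P.toFunctor X (P.obj Y) ≫ P.obj X ◁ t) (P.prodApp_naturality h)
  have hμ : P.map (X ◁ P.prodApp N.A) ≫ P.leftFusion X N.A =
      P.leftFusion X (P.obj N.A) ≫ P.obj X ◁ P.prodApp N.A := by
    unfold leftFusion
    rw [← reassoc_of% δ_natural_right, Category.assoc, ← MonoidalCategory.whiskerLeft_comp,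
      ← MonoidalCategory.whiskerLeft_comp]
    exact congrArg (fun t => δ P.toFunctor X _ ≫ P.obj X ◁ t) (P.prodApp_assoc N.A)
  -- The inverse lifts `N` to the free module along the unit, inverts fusion there, and projects
  -- back along the action.
  refine ⟨P.obj X ◁ P.unitApp N.A ≫ CategoryTheory.inv (P.leftFusion X N.A) ≫ P.map (X ◁ N.a),
    ?_, ?_⟩
  -- The action is split by the unit, so the identity may be checked on `P (X ⊗ P N)`, where
  -- naturality of `H^l` and associativity of the action apply.
  · have : Epi (P.map (X ◁ N.a)) := by
      have : IsSplitEpi (P.map (X ◁ N.a)) := ⟨⟨P.map (X ◁ P.unitApp N.A), by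
        rw [← Functor.map_comp, ← MonoidalCategory.whiskerLeft_comp, unit_act]; simp⟩⟩
      infer_instance
    rw [← cancel_epi (P.map (X ◁ N.a)), reassoc_of% act, ← MonoidalCategory.whiskerLeft_comp_assoc,
      unitApp_naturality, MonoidalCategory.whiskerLeft_comp_assoc]
    have hμ' : P.obj X ◁ P.prodApp N.A ≫ CategoryTheory.inv (P.leftFusion X N.A) =
        CategoryTheory.inv (P.leftFusion X (P.obj N.A)) ≫ P.map (X ◁ P.prodApp N.A) := by
      rw [IsIso.comp_inv_eq, Category.assoc, IsIso.eq_inv_comp, hμ]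
    have nat' : P.obj X ◁ P.map N.a ≫ CategoryTheory.inv (P.leftFusion X N.A) =
        CategoryTheory.inv (P.leftFusion X (P.obj N.A)) ≫ P.map (X ◁ P.map N.a) := by
      rw [IsIso.comp_inv_eq, Category.assoc, IsIso.eq_inv_comp, nat]
    rw [reassoc_of% nat', ← Functor.map_comp, ← MonoidalCategory.whiskerLeft_comp, hN,
      MonoidalCategory.whiskerLeft_comp, Functor.map_comp, ← reassoc_of% hμ',
      ← MonoidalCategory.whiskerLeft_comp_assoc, unitApp_prodApp]
    simp
  · rw [Category.assoc, Category.assoc, act, IsIso.inv_hom_id_assoc,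
      ← MonoidalCategory.whiskerLeft_comp, unit_act, MonoidalCategory.whiskerLeft_id]

theorem isIso_modRightFusion (hP : P.IsHopf) (X : C) (N : P.Mod) :
    IsIso (modRightFusion N X) := by
  have hH (Y : C) : IsIso (P.rightFusion Y X) := hP.isIso_rightFusion Y X
  have hN : P.map N.a ≫ N.a = P.prodApp N.A ≫ N.a := N.assoc.symm
  have act : P.map (N.a ▷ X) ≫ modRightFusion N X =
      P.rightFusion N.A X ≫ N.a ▷ P.obj X := by
    unfold modRightFusion rightFusion
    rw [← reassoc_of% δ_natural_left, Category.assoc, ← comp_whiskerRight, hN, comp_whiskerRight]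
    rfl
  have nat {Y Z : C} (h : Y ⟶ Z) : P.map (P.map h ▷ X) ≫ P.rightFusion Z X =
      P.rightFusion Y X ≫ P.map h ▷ P.obj X := by
    unfold rightFusion
    rw [← reassoc_of% δ_natural_left, Category.assoc, ← comp_whiskerRight, ← comp_whiskerRight]
    exact congrArg (fun t => δ P.toFunctor (P.obj Y) X ≫ t ▷ P.obj X) (P.prodApp_naturality h)
  have hμ : P.map (P.prodApp N.A ▷ X) ≫ P.rightFusion N.A X =
      P.rightFusion (P.obj N.A) X ≫ P.prodApp N.A ▷ P.obj X := by
    unfold rightFusion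
    rw [← reassoc_of% δ_natural_left, Category.assoc, ← comp_whiskerRight, ← comp_whiskerRight]
    exact congrArg (fun t => δ P.toFunctor _ X ≫ t ▷ P.obj X) (P.prodApp_assoc N.A)
  refine ⟨P.unitApp N.A ▷ P.obj X ≫ CategoryTheory.inv (P.rightFusion N.A X) ≫ P.map (N.a ▷ X),
    ?_, ?_⟩
  · have : Epi (P.map (N.a ▷ X)) := by
      have : IsSplitEpi (P.map (N.a ▷ X)) := ⟨⟨P.map (P.unitApp N.A ▷ X), by
        rw [← Functor.map_comp, ← comp_whiskerRight, unit_act]; simp⟩⟩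
      infer_instance
    rw [← cancel_epi (P.map (N.a ▷ X)), reassoc_of% act, ← comp_whiskerRight_assoc,
      unitApp_naturality, comp_whiskerRight_assoc]
    have hμ' : P.prodApp N.A ▷ P.obj X ≫ CategoryTheory.inv (P.rightFusion N.A X) =
        CategoryTheory.inv (P.rightFusion (P.obj N.A) X) ≫ P.map (P.prodApp N.A ▷ X) := by
      rw [IsIso.comp_inv_eq, Category.assoc, IsIso.eq_inv_comp, hμ]
    have nat' : P.map N.a ▷ P.obj X ≫ CategoryTheory.inv (P.rightFusion N.A X) =
        CategoryTheory.inv (P.rightFusion (P.obj N.A) X) ≫ P.map (P.map N.a ▷ X) := by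
      rw [IsIso.comp_inv_eq, Category.assoc, IsIso.eq_inv_comp, nat]
    rw [reassoc_of% nat', ← Functor.map_comp, ← comp_whiskerRight, hN,
      comp_whiskerRight, Functor.map_comp, ← reassoc_of% hμ',
      ← comp_whiskerRight_assoc, unitApp_prodApp]
    simp
  · rw [Category.assoc, Category.assoc, act, IsIso.inv_hom_id_assoc,
      ← comp_whiskerRight, unit_act, id_whiskerRight]

end Fusion

/-! ### The universal property of the induced module -/

/-- The `P`-module induced from the unit `T`-module along a morphism `f : T ⟶ P`, with its unit, in
the form of a universal property that is stable under tensoring with a `P`-module on the right or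
on the left. -/
structure InducedUnit {T P : Bimonad C} (f : T ⟶ P) where
  /-- The induced module. -/
  mod : P.Mod
  /-- The unit of the induced module. -/
  unit : 𝟙_ C ⟶ mod.A
  lin_unit : Lin T T.unitAct (pull f mod.a) unit
  exists_left (N N' : P.Mod) (h : N.A ⟶ N'.A) (hh : Lin T (pull f N.a) (pull f N'.a) h) :
    ∃ k : mod.A ⊗ N.A ⟶ N'.A, Lin P (P.tens mod.a N.a) N'.a k ∧ unit ▷ N.A ≫ k = (λ_ N.A).hom ≫ h
  left_ext (N N' : P.Mod) (k k' : mod.A ⊗ N.A ⟶ N'.A) (hk : Lin P (P.tens mod.a N.a) N'.a k)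
    (hk' : Lin P (P.tens mod.a N.a) N'.a k') (h : unit ▷ N.A ≫ k = unit ▷ N.A ≫ k') : k = k'
  exists_right (N N' : P.Mod) (h : N.A ⟶ N'.A) (hh : Lin T (pull f N.a) (pull f N'.a) h) :
    ∃ k : N.A ⊗ mod.A ⟶ N'.A, Lin P (P.tens N.a mod.a) N'.a k ∧ N.A ◁ unit ≫ k = (ρ_ N.A).hom ≫ h
  right_ext (N N' : P.Mod) (k k' : N.A ⊗ mod.A ⟶ N'.A) (hk : Lin P (P.tens N.a mod.a) N'.a k)
    (hk' : Lin P (P.tens N.a mod.a) N'.a k') (h : N.A ◁ unit ≫ k = N.A ◁ unit ≫ k') : k = k'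

/-! ### Construction of the induced module as a reflexive coequalizer -/

variable {T P : Bimonad C}

theorem lin_app (f : T ⟶ P) (X : C) : Lin T (T.prodApp X) (pull f (P.prodApp X)) (f.app X) := by
  unfold Lin pull
  rw [prodApp_app, reassoc_of% (app_naturality f)]

theorem lin_unitAct (T : Bimonad C) : Lin T (T.prodApp (𝟙_ C)) T.unitAct T.unitAct :=
  Lin.action (unitMod T)

/-- The second of the two morphisms whose coequalizer is the induced module. -/
def indMap (f : T ⟶ P) : P.obj (T.obj (𝟙_ C)) ⟶ P.obj (𝟙_ C) :=
  P.map (f.app (𝟙_ C)) ≫ P.prodApp (𝟙_ C)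

theorem lin_indMap (f : T ⟶ P) :
    Lin P (P.prodApp (T.obj (𝟙_ C))) (P.prodApp (𝟙_ C)) (indMap f) :=
  Lin.extend (P.freeMod (𝟙_ C)) (f.app (𝟙_ C))

theorem unitApp_indMap (f : T ⟶ P) : P.unitApp (T.obj (𝟙_ C)) ≫ indMap f = f.app (𝟙_ C) :=
  unitApp_extend (P.freeMod (𝟙_ C)) (f.app (𝟙_ C))

/-- The unit of `T` at `𝟙_` is split by `T₀` and is carried by `f` to the unit of `P`; its image
under `P` is therefore a section of both maps. -/
theorem isReflexivePair_indMap (f : T ⟶ P) : IsReflexivePair (P.map T.unitAct) (indMap f) where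
  common_section' := ⟨P.map (T.unitApp (𝟙_ C)),
    by rw [← Functor.map_comp, unitApp_counit, Functor.map_id],
    by rw [indMap, ← Functor.map_comp_assoc, unitApp_app, map_unitApp_prodApp]⟩

section

variable {f : T ⟶ P} {B : C} {b : P.obj B ⟶ B} {q : P.obj (𝟙_ C) ⟶ B}

/-- Both sides of the linearity equation equal `f_𝟙` followed by `q`: one because `q` is `P`-linear,
the other by the coequalizer condition evaluated on the unit. -/
theorem lin_unit_of_coequalizer (hq : P.map T.unitAct ≫ q = indMap f ≫ q)
    (hb : Lin P (P.prodApp (𝟙_ C)) b q) :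
    Lin T T.unitAct (pull f b) (P.unitApp (𝟙_ C) ≫ q) := by
  have h1 : T.map (P.unitApp (𝟙_ C) ≫ q) ≫ pull f b = f.app (𝟙_ C) ≫ q := by
    unfold Lin at hb
    rw [pull, ← Category.assoc, app_naturality, Category.assoc, Functor.map_comp_assoc, hb,
      ← Category.assoc (P.map _), map_unitApp_prodApp, Category.id_comp]
  have h2 : T.unitAct ≫ P.unitApp (𝟙_ C) ≫ q = f.app (𝟙_ C) ≫ q := by
    rw [← Category.assoc, P.unitApp_naturality, Category.assoc, hq, ← Category.assoc,
      unitApp_indMap]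
  exact h1.trans h2.symm

/-- Fusion makes `P 𝟙 ⊗ N` the free `P`-module on `𝟙 ⊗ N`, so any map `N ⟶ N'` extends to it. The
`T`-linearity of `h` is what makes the extension pass to the quotient `B ⊗ N`. -/
theorem exists_left_of_coequalizer (hP : P.IsHopf) (hT : T.IsHopf) (N N' : P.Mod)
    (hPq : Epi (P.map (q ▷ N.A)))
    (hq : IsReflexiveCoequalizer (P.map T.unitAct ▷ N.A) (indMap f ▷ N.A) (q ▷ N.A))
    (hb : Lin P (P.prodApp (𝟙_ C)) b q) (h : N.A ⟶ N'.A)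
    (hh : Lin T (pull f N.a) (pull f N'.a) h) :
    ∃ k : B ⊗ N.A ⟶ N'.A, Lin P (P.tens b N.a) N'.a k ∧
      (P.unitApp (𝟙_ C) ≫ q) ▷ N.A ≫ k = (λ_ N.A).hom ≫ h := by
  have i1 := isIso_modLeftFusion hP (𝟙_ C) N
  have i2 := isIso_modLeftFusion hP (T.obj (𝟙_ C)) N
  -- The Hopf property of `T`, applied to the restriction of `N`, makes `T 𝟙 ⊗ N` a free `T`-module.
  -- Fusion is restated with `N.A` and `pull f N.a` in place of the fields of `res f N`.
  obtain ⟨Φ, i3, l1, e1⟩ : ∃ Φ : T.obj (𝟙_ C ⊗ N.A) ⟶ T.obj (𝟙_ C) ⊗ N.A, IsIso Φ ∧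
      Lin T (T.prodApp (𝟙_ C ⊗ N.A)) (T.tens (T.prodApp (𝟙_ C)) (pull f N.a)) Φ ∧
        T.unitApp (𝟙_ C ⊗ N.A) ≫ Φ = T.unitApp (𝟙_ C) ▷ N.A :=
    ⟨modLeftFusion (𝟙_ C) (res f N), isIso_modLeftFusion hT (𝟙_ C) (res f N),
      lin_modLeftFusion (𝟙_ C) (res f N), unitApp_modLeftFusion (𝟙_ C) (res f N)⟩
  obtain ⟨k, hk, ek⟩ : ∃ k : P.obj (𝟙_ C) ⊗ N.A ⟶ N'.A,
      Lin P (P.tens (P.prodApp (𝟙_ C)) N.a) N'.a k ∧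
        P.unitApp (𝟙_ C) ▷ N.A ≫ k = (λ_ N.A).hom ≫ h := by
    refine ⟨inv (modLeftFusion (𝟙_ C) N) ≫ P.map ((λ_ N.A).hom ≫ h) ≫ N'.a, ?_, ?_⟩
    · exact ((lin_modLeftFusion (𝟙_ C) N).inv (by simp) (by simp)).comp (Lin.extend N' _)
    · rw [← unitApp_modLeftFusion, Category.assoc, IsIso.hom_inv_id_assoc, unitApp_extend]
  -- Two reductions to generators: fusion for `P` reduces the equality to maps out of `T 𝟙 ⊗ N`,
  -- then fusion for `T` reduces it to maps out of `𝟙 ⊗ N`.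
  have hk' : P.map T.unitAct ▷ N.A ≫ k = indMap f ▷ N.A ≫ k := by
    rw [← cancel_epi (modLeftFusion (T.obj (𝟙_ C)) N)]
    refine Lin.free_ext (b := N'.a)
      ((lin_modLeftFusion _ N).comp (((Lin.free_map _).whiskerRight N.a).comp hk))
      ((lin_modLeftFusion _ N).comp (((lin_indMap f).whiskerRight N.a).comp hk)) ?_
    simp only [reassoc_of% (unitApp_modLeftFusion (P := P))]
    rw [← comp_whiskerRight_assoc,
      ← comp_whiskerRight_assoc, unitApp_indMap, ← P.unitApp_naturality, comp_whiskerRight_assoc,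
      ek, ← cancel_epi Φ]
    -- The first map is `T`-linear because `h` is, the second because `f_𝟙` and the restriction of
    -- `k` along `f` are.
    refine Lin.free_ext (b := pull f N'.a)
      (l1.comp (((lin_unitAct T).whiskerRight _).comp ((Lin.leftUnitor _).comp hh)))
      (l1.comp (((lin_app f _).whiskerRight _).comp (by
        have := hk.pull (f := f)
        rwa [pull_tens] at this))) ?_
    rw [reassoc_of% e1, reassoc_of% e1]
    rw [← comp_whiskerRight_assoc, ← comp_whiskerRight_assoc, unitApp_app, unitApp_counit, ek]
    simp
  obtain ⟨l, hl⟩ := hq.exists_desc k hk'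
  refine ⟨l, ?_, by rw [comp_whiskerRight_assoc, hl, ek]⟩
  -- Linearity descends from `k` to `l` because `P (q ⊗ N)` is an epimorphism.
  have e := (hb.whiskerRight N.a)
  unfold Lin at e hk ⊢
  rw [← cancel_epi (P.map (q ▷ N.A)), ← Functor.map_comp_assoc, hl, hk, reassoc_of% e, hl]

/-- Precomposing with the epimorphism `q ⊗ N` and with fusion gives linear maps out of a free
module, which are determined on the unit. -/
theorem left_ext_of_coequalizer (hP : P.IsHopf) (N N' : P.Mod) (hq : Epi (q ▷ N.A))
    (hb : Lin P (P.prodApp (𝟙_ C)) b q) (k k' : B ⊗ N.A ⟶ N'.A)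
    (hk : Lin P (P.tens b N.a) N'.a k) (hk' : Lin P (P.tens b N.a) N'.a k')
    (h : (P.unitApp (𝟙_ C) ≫ q) ▷ N.A ≫ k = (P.unitApp (𝟙_ C) ≫ q) ▷ N.A ≫ k') : k = k' := by
  have i1 := isIso_modLeftFusion hP (𝟙_ C) N
  rw [← cancel_epi (q ▷ N.A), ← cancel_epi (modLeftFusion (𝟙_ C) N)]
  refine Lin.free_ext (b := N'.a)
    ((lin_modLeftFusion _ N).comp ((hb.whiskerRight N.a).comp hk))
    ((lin_modLeftFusion _ N).comp ((hb.whiskerRight N.a).comp hk')) ?_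
  simp only [reassoc_of% (unitApp_modLeftFusion (P := P))]
  rw [← comp_whiskerRight_assoc, h,
    comp_whiskerRight_assoc]

theorem exists_right_of_coequalizer (hP : P.IsHopf) (hT : T.IsHopf) (N N' : P.Mod)
    (hPq : Epi (P.map (N.A ◁ q)))
    (hq : IsReflexiveCoequalizer (N.A ◁ P.map T.unitAct) (N.A ◁ indMap f) (N.A ◁ q))
    (hb : Lin P (P.prodApp (𝟙_ C)) b q) (h : N.A ⟶ N'.A)
    (hh : Lin T (pull f N.a) (pull f N'.a) h) :
    ∃ k : N.A ⊗ B ⟶ N'.A, Lin P (P.tens N.a b) N'.a k ∧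
      N.A ◁ (P.unitApp (𝟙_ C) ≫ q) ≫ k = (ρ_ N.A).hom ≫ h := by
  have i1 := isIso_modRightFusion hP (𝟙_ C) N
  have i2 := isIso_modRightFusion hP (T.obj (𝟙_ C)) N
  obtain ⟨Φ, i3, l1, e1⟩ : ∃ Φ : T.obj (N.A ⊗ 𝟙_ C) ⟶ N.A ⊗ T.obj (𝟙_ C), IsIso Φ ∧
      Lin T (T.prodApp (N.A ⊗ 𝟙_ C)) (T.tens (pull f N.a) (T.prodApp (𝟙_ C))) Φ ∧
        T.unitApp (N.A ⊗ 𝟙_ C) ≫ Φ = N.A ◁ T.unitApp (𝟙_ C) :=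
    ⟨modRightFusion (res f N) (𝟙_ C), isIso_modRightFusion hT (𝟙_ C) (res f N),
      lin_modRightFusion (𝟙_ C) (res f N), unitApp_modRightFusion (𝟙_ C) (res f N)⟩
  obtain ⟨k, hk, ek⟩ : ∃ k : N.A ⊗ P.obj (𝟙_ C) ⟶ N'.A,
      Lin P (P.tens N.a (P.prodApp (𝟙_ C))) N'.a k ∧
        N.A ◁ P.unitApp (𝟙_ C) ≫ k = (ρ_ N.A).hom ≫ h := by
    refine ⟨inv (modRightFusion N (𝟙_ C)) ≫ P.map ((ρ_ N.A).hom ≫ h) ≫ N'.a, ?_, ?_⟩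
    · exact ((lin_modRightFusion (𝟙_ C) N).inv (by simp) (by simp)).comp (Lin.extend N' _)
    · rw [← unitApp_modRightFusion, Category.assoc, IsIso.hom_inv_id_assoc, unitApp_extend]
  have hk' : N.A ◁ P.map T.unitAct ≫ k = N.A ◁ indMap f ≫ k := by
    rw [← cancel_epi (modRightFusion N (T.obj (𝟙_ C)))]
    refine Lin.free_ext (b := N'.a)
      ((lin_modRightFusion _ N).comp (((Lin.free_map _).whiskerLeft N.a).comp hk))
      ((lin_modRightFusion _ N).comp (((lin_indMap f).whiskerLeft N.a).comp hk)) ?_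
    simp only [reassoc_of% (unitApp_modRightFusion (P := P))]
    rw [← MonoidalCategory.whiskerLeft_comp_assoc, ← MonoidalCategory.whiskerLeft_comp_assoc,
      unitApp_indMap, ← P.unitApp_naturality, MonoidalCategory.whiskerLeft_comp_assoc,
      ek, ← cancel_epi Φ]
    refine Lin.free_ext (b := pull f N'.a)
      (l1.comp (((lin_unitAct T).whiskerLeft _).comp ((Lin.rightUnitor _).comp hh)))
      (l1.comp (((lin_app f _).whiskerLeft _).comp (by
        have := hk.pull (f := f)
        rwa [pull_tens] at this))) ?_
    rw [reassoc_of% e1, reassoc_of% e1]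
    rw [← MonoidalCategory.whiskerLeft_comp_assoc, ← MonoidalCategory.whiskerLeft_comp_assoc,
      unitApp_app, unitApp_counit, ek]
    simp
  obtain ⟨l, hl⟩ := hq.exists_desc k hk'
  refine ⟨l, ?_, by rw [MonoidalCategory.whiskerLeft_comp_assoc, hl, ek]⟩
  have e := (hb.whiskerLeft N.a)
  unfold Lin at e hk ⊢
  rw [← cancel_epi (P.map (N.A ◁ q)), ← Functor.map_comp_assoc, hl, hk, reassoc_of% e, hl]

theorem right_ext_of_coequalizer (hP : P.IsHopf) (N N' : P.Mod) (hq : Epi (N.A ◁ q))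
    (hb : Lin P (P.prodApp (𝟙_ C)) b q) (k k' : N.A ⊗ B ⟶ N'.A)
    (hk : Lin P (P.tens N.a b) N'.a k) (hk' : Lin P (P.tens N.a b) N'.a k')
    (h : N.A ◁ (P.unitApp (𝟙_ C) ≫ q) ≫ k = N.A ◁ (P.unitApp (𝟙_ C) ≫ q) ≫ k') : k = k' := by
  have i1 := isIso_modRightFusion hP (𝟙_ C) N
  rw [← cancel_epi (N.A ◁ q), ← cancel_epi (modRightFusion N (𝟙_ C))]
  refine Lin.free_ext (b := N'.a)
    ((lin_modRightFusion _ N).comp ((hb.whiskerLeft N.a).comp hk))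
    ((lin_modRightFusion _ N).comp ((hb.whiskerLeft N.a).comp hk')) ?_
  simp only [reassoc_of% (unitApp_modRightFusion (P := P))]
  rw [← MonoidalCategory.whiskerLeft_comp_assoc, h, MonoidalCategory.whiskerLeft_comp_assoc]

end

/-- Under the exactness hypotheses, the coequalizer of `P T₀` and `μ_𝟙 P f_𝟙` carries the structure
of a `P`-module induced from the unit `T`-module. -/
theorem nonempty_inducedUnit [HasReflexiveCoequalizers C]
    (hleft : ∀ X : C, Monad.PreservesColimitOfIsReflexivePair (tensorLeft X))
    (hright : ∀ X : C, Monad.PreservesColimitOfIsReflexivePair (tensorRight X))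
    (hP : P.IsHopf) (hT : T.IsHopf)
    (hPres : Monad.PreservesColimitOfIsReflexivePair P.toFunctor) (f : T ⟶ P) :
    Nonempty (InducedUnit f) := by
  obtain ⟨B, q, hq⟩ := exists_isReflexiveCoequalizer _ _ (isReflexivePair_indMap f)
  have hPq := hq.map P.toFunctor hPres
  have e0 := hq.epi
  have e1 : Epi (P.map q) := hPq.epi
  have e2 : Epi (P.map (P.map q)) := (hPq.map P.toFunctor hPres).epi
  -- Since `P` preserves the coequalizer, the free action on `P 𝟙` descends to `B`; both parallel
  -- maps are linear between free modules.
  obtain ⟨b, hb⟩ : ∃ b : P.obj B ⟶ B, P.map q ≫ b = P.prodApp (𝟙_ C) ≫ q := by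
    refine hPq.exists_desc _ ?_
    have h1 := P.prodApp_naturality T.unitAct
    have h2 : P.map (indMap f) ≫ P.prodApp (𝟙_ C) = P.prodApp (T.obj (𝟙_ C)) ≫ indMap f :=
      lin_indMap f
    change P.map (P.map T.unitAct) ≫ _ = P.map (indMap f) ≫ _
    rw [reassoc_of% h1, reassoc_of% h2, hq.condition]
  let M : P.Mod :=
    { A := B
      a := b
      unit := by
        change P.unitApp B ≫ b = 𝟙 B
        rw [← cancel_epi q, ← Category.assoc, P.unitApp_naturality, Category.assoc, hb,
          ← Category.assoc, unitApp_prodApp]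
        simp
      assoc := by
        change P.prodApp B ≫ b = P.map b ≫ b
        -- Associativity is inherited from `P 𝟙` through `P P q`, an epimorphism because `P`
        -- preserves the coequalizer twice.
        rw [← cancel_epi (P.map (P.map q)), ← Category.assoc, P.prodApp_naturality,
          Category.assoc, hb, ← Functor.map_comp_assoc, hb, Functor.map_comp_assoc, hb,
          ← Category.assoc, ← Category.assoc, P.prodApp_assoc] }
  have hr (X : C) : IsReflexiveCoequalizer (P.map T.unitAct ▷ X) (indMap f ▷ X) (q ▷ X) :=
    hq.map (tensorRight X) (hright X)
  have hl (X : C) : IsReflexiveCoequalizer (X ◁ P.map T.unitAct) (X ◁ indMap f) (X ◁ q) :=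
    hq.map (tensorLeft X) (hleft X)
  exact ⟨{
    mod := M
    unit := P.unitApp (𝟙_ C) ≫ q
    lin_unit := lin_unit_of_coequalizer hq.condition hb
    exists_left := fun N N' => exists_left_of_coequalizer hP hT N N'
      ((hr N.A).map P.toFunctor hPres).epi (hr N.A) hb
    left_ext := fun N N' => left_ext_of_coequalizer hP N N' (hr N.A).epi hb
    exists_right := fun N N' => exists_right_of_coequalizer hP hT N N'
      ((hl N.A).map P.toFunctor hPres).epi (hl N.A) hb
    right_ext := fun N N' => right_ext_of_coequalizer hP N N' (hl N.A).epi hb }⟩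

/-! ### Extension and uniqueness principles for bare actions -/

/-- A morphism `a : T X ⟶ X` is an action of the bimonad `T` on `X`. -/
class IsAct (T : Bimonad C) {X : C} (a : T.obj X ⟶ X) : Prop where
  unitApp_act (T a) : T.unitApp X ≫ a = 𝟙 X
  prodApp_act (T a) : T.prodApp X ≫ a = T.map a ≫ a

/-- The module defined by an action. -/
abbrev modOf (T : Bimonad C) {X : C} (a : T.obj X ⟶ X) [h : IsAct T a] : T.Mod :=
  ⟨X, a, h.unitApp_act, h.prodApp_act⟩

/-- With these instances, actions assembled from `tens` and `pull` are recognized as modules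
automatically, and identifications such as `f^* (M ⊗ N) = f^* M ⊗ f^* N` are rewritten as equations
of morphisms (`pull_tens`) on a fixed object. -/
instance (T : Bimonad C) (M : T.Mod) : IsAct T M.a := ⟨M.unit, M.assoc⟩

instance (T : Bimonad C) : IsAct T T.unitAct := inferInstanceAs (IsAct T (unitMod T).a)

instance (T : Bimonad C) (X : C) : IsAct T (T.prodApp X) :=
  inferInstanceAs (IsAct T (T.freeMod X).a)

instance (T : Bimonad C) {X Y : C} (a : T.obj X ⟶ X) (b : T.obj Y ⟶ Y) [IsAct T a] [IsAct T b] :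
    IsAct T (T.tens a b) :=
  inferInstanceAs (IsAct T (modOf T a ⊗ modOf T b).a)

instance {T P : Bimonad C} (f : T ⟶ P) {X : C} (a : P.obj X ⟶ X) [IsAct P a] :
    IsAct T (pull f a) :=
  inferInstanceAs (IsAct T (res f (modOf P a)).a)

namespace InducedUnit

section Universal

variable {f : T ⟶ P} (I : InducedUnit f) {X Y : C} (n : P.obj X ⟶ X) (n' : P.obj Y ⟶ Y)
  [IsAct P n] [IsAct P n']

/-- The object underlying the induced module. -/
abbrev obj : C := I.mod.A

/-- The action of `P` on the induced module. -/
abbrev act : P.obj I.obj ⟶ I.obj := I.mod.a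

section

variable (h : X ⟶ Y) (hh : Lin T (pull f n) (pull f n') h)

/-- The `P`-linear morphism `B ⊗ N ⟶ N'` extending a `T`-linear morphism `N ⟶ N'`. -/
noncomputable def liftLeft : I.obj ⊗ X ⟶ Y :=
  (I.exists_left (modOf P n) (modOf P n') h hh).choose

theorem lin_liftLeft : Lin P (P.tens I.act n) n' (I.liftLeft n n' h hh) :=
  (I.exists_left (modOf P n) (modOf P n') h hh).choose_spec.1

theorem unit_liftLeft : I.unit ▷ X ≫ I.liftLeft n n' h hh = (λ_ X).hom ≫ h :=
  (I.exists_left (modOf P n) (modOf P n') h hh).choose_spec.2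

/-- The `P`-linear morphism `N ⊗ B ⟶ N'` extending a `T`-linear morphism `N ⟶ N'`. -/
noncomputable def liftRight : X ⊗ I.obj ⟶ Y :=
  (I.exists_right (modOf P n) (modOf P n') h hh).choose

theorem lin_liftRight : Lin P (P.tens n I.act) n' (I.liftRight n n' h hh) :=
  (I.exists_right (modOf P n) (modOf P n') h hh).choose_spec.1

theorem unit_liftRight : X ◁ I.unit ≫ I.liftRight n n' h hh = (ρ_ X).hom ≫ h :=
  (I.exists_right (modOf P n) (modOf P n') h hh).choose_spec.2

end

variable {n n'}

theorem hom_ext_left {k k' : I.obj ⊗ X ⟶ Y} (hk : Lin P (P.tens I.act n) n' k)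
    (hk' : Lin P (P.tens I.act n) n' k') (h : I.unit ▷ X ≫ k = I.unit ▷ X ≫ k') : k = k' :=
  I.left_ext (modOf P n) (modOf P n') k k' hk hk' h

theorem hom_ext_right {k k' : X ⊗ I.obj ⟶ Y} (hk : Lin P (P.tens n I.act) n' k)
    (hk' : Lin P (P.tens n I.act) n' k') (h : X ◁ I.unit ≫ k = X ◁ I.unit ≫ k') : k = k' :=
  I.right_ext (modOf P n) (modOf P n') k k' hk hk' h

theorem hom_ext {k k' : I.obj ⟶ Y} (hk : Lin P I.act n' k) (hk' : Lin P I.act n' k')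
    (h : I.unit ≫ k = I.unit ≫ k') : k = k' := by
  rw [← cancel_epi (ρ_ I.obj).hom]
  refine I.hom_ext_left ((Lin.rightUnitor _).comp hk) ((Lin.rightUnitor _).comp hk') ?_
  rw [rightUnitor_naturality_assoc, rightUnitor_naturality_assoc, h]

variable (n')

/-- The `P`-linear morphism `B ⟶ N` extending a `T`-linear morphism `𝟙_ ⟶ N`. -/
noncomputable def lift (h : 𝟙_ C ⟶ Y) (hh : Lin T T.unitAct (pull f n') h) : I.obj ⟶ Y :=
  (ρ_ I.obj).inv ≫ I.liftLeft P.unitAct n' h (by rwa [pull_unitAct])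

theorem lin_lift (h : 𝟙_ C ⟶ Y) (hh : Lin T T.unitAct (pull f n') h) :
    Lin P I.act n' (I.lift n' h hh) :=
  (Lin.rightUnitor_inv _).comp (I.lin_liftLeft _ _ _ _)

theorem unit_lift (h : 𝟙_ C ⟶ Y) (hh : Lin T T.unitAct (pull f n') h) :
    I.unit ≫ I.lift n' h hh = h := by
  rw [lift, rightUnitor_inv_naturality_assoc, unit_liftLeft, unitors_equal]
  simp

end Universal

variable {r : Retract T P} (I : InducedUnit r.i)

/-! ### The structure morphisms -/

theorem pull_pull_retract {X : C} (a : T.obj X ⟶ X) : pull r.i (pull r.r a) = a :=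
  pull_pull r.retract a

/-- The action of `T` on the induced module. -/
abbrev tact : T.obj I.obj ⟶ I.obj := pull r.i I.act

/-- The action of `P` on the induced module obtained by restriction along `P ⟶ T ⟶ P`. -/
abbrev ract : P.obj I.obj ⟶ I.obj := pull r.r I.tact

theorem lin_unit_ract : Lin P P.unitAct I.ract I.unit := by
  have h := I.lin_unit.pull (f := r.r)
  rwa [pull_unitAct] at h

/-- The product. -/
noncomputable def mul : I.obj ⊗ I.obj ⟶ I.obj :=
  -- The second factor carries `g^* f^*` of the action on `B`; its restriction along `f` is again
  -- that of `B`, so the identity may be extended.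
  I.liftLeft I.ract I.act (𝟙 _) (by rw [pull_pull_retract]; exact Lin.id _)

theorem lin_mul : Lin P (P.tens I.act I.ract) I.act I.mul := I.lin_liftLeft _ _ _ _

theorem unit_mul : I.unit ▷ I.obj ≫ I.mul = (λ_ _).hom := by
  rw [mul, unit_liftLeft, Category.comp_id]

/-- The coproduct. -/
noncomputable def comul : I.obj ⟶ I.obj ⊗ I.obj :=
  I.lift (P.tens I.act I.act) ((λ_ (𝟙_ C)).inv ≫ (I.unit ⊗ₘ I.unit)) (by
    rw [pull_tens]
    exact (Lin.leftUnitor_inv _).comp (I.lin_unit.tensor I.lin_unit))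

theorem lin_comul : Lin P I.act (P.tens I.act I.act) I.comul := I.lin_lift _ _ _

theorem unit_comul : I.unit ≫ I.comul = (λ_ (𝟙_ C)).inv ≫ (I.unit ⊗ₘ I.unit) :=
  I.unit_lift _ _ _

/-- The counit. -/
noncomputable def counit : I.obj ⟶ 𝟙_ C :=
  I.lift P.unitAct (𝟙 _) (by rw [pull_unitAct]; exact Lin.id _)

theorem lin_counit : Lin P I.act P.unitAct I.counit := I.lin_lift _ _ _

theorem unit_counit : I.unit ≫ I.counit = 𝟙 _ := I.unit_lift _ _ _

section HalfBraiding

variable {X Y : C} (a : T.obj X ⟶ X) (c : T.obj Y ⟶ Y) [IsAct T a] [IsAct T c]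

/-- The half-braiding with a `T`-module. -/
noncomputable def half : I.obj ⊗ X ⟶ X ⊗ I.obj :=
  -- The half-braiding is forced by its value on the generator: `u ⊗ x` is sent to `x ⊗ u`.
  I.liftLeft (pull r.r a) (P.tens (pull r.r a) I.act) ((ρ_ X).inv ≫ X ◁ I.unit) (by
    rw [pull_tens, pull_pull_retract]
    exact (Lin.rightUnitor_inv _).comp (I.lin_unit.whiskerLeft _))

theorem lin_half : Lin P (P.tens I.act (pull r.r a)) (P.tens (pull r.r a) I.act) (I.half a) :=
  I.lin_liftLeft _ _ _ _

theorem unit_half : I.unit ▷ X ≫ I.half a = (λ_ X).hom ≫ (ρ_ X).inv ≫ X ◁ I.unit :=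
  I.unit_liftLeft _ _ _ _

/-- The inverse of the half-braiding with a `T`-module. -/
noncomputable def halfInv : X ⊗ I.obj ⟶ I.obj ⊗ X :=
  I.liftRight (pull r.r a) (P.tens I.act (pull r.r a)) ((λ_ X).inv ≫ I.unit ▷ X) (by
    rw [pull_tens, pull_pull_retract]
    exact (Lin.leftUnitor_inv _).comp (I.lin_unit.whiskerRight _))

theorem lin_halfInv :
    Lin P (P.tens (pull r.r a) I.act) (P.tens I.act (pull r.r a)) (I.halfInv a) :=
  I.lin_liftRight _ _ _ _

theorem unit_halfInv : X ◁ I.unit ≫ I.halfInv a = (ρ_ X).hom ≫ (λ_ X).inv ≫ I.unit ▷ X :=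
  I.unit_liftRight _ _ _ _

/-- The composite is a `P`-linear endomorphism of `B ⊗ X` fixing `u ⊗ X`, hence the identity. The
opposite composite uses uniqueness for `X ⊗ B`. -/
theorem half_halfInv : I.half a ≫ I.halfInv a = 𝟙 _ := by
  refine I.hom_ext_left ((I.lin_half a).comp (I.lin_halfInv a)) (Lin.id _) ?_
  rw [reassoc_of% I.unit_half, unit_halfInv]
  simp

theorem halfInv_half : I.halfInv a ≫ I.half a = 𝟙 _ := by
  refine I.hom_ext_right ((I.lin_halfInv a).comp (I.lin_half a)) (Lin.id _) ?_
  rw [reassoc_of% I.unit_halfInv, unit_half]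
  simp

variable {a c} in
theorem half_naturality {h : X ⟶ Y} (hh : Lin T a c h) :
    I.obj ◁ h ≫ I.half c = I.half a ≫ h ▷ I.obj := by
  have hg := hh.pull (f := r.r)
  refine I.hom_ext_left ((hg.whiskerLeft I.act).comp (I.lin_half c))
    ((I.lin_half a).comp (hg.whiskerRight _)) ?_
  rw [reassoc_of% I.unit_half, ← whisker_exchange_assoc, unit_half, whisker_exchange]
  simp

/-- Both sides are `P`-linear and move `u` past `X ⊗ Y`: at once on the left, one factor at a time
on the right. -/
theorem half_tens : I.half (T.tens a c) = (α_ _ _ _).inv ≫ I.half a ▷ Y ≫ (α_ _ _ _).hom ≫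
    X ◁ I.half c ≫ (α_ _ _ _).inv := by
  have h := I.lin_half (T.tens a c)
  rw [pull_tens] at h
  refine I.hom_ext_left h ((Lin.assoc_inv _ _ _).comp (((I.lin_half a).whiskerRight _).comp
    ((Lin.assoc _ _ _).comp (((I.lin_half c).whiskerLeft _).comp (Lin.assoc_inv _ _ _))))) ?_
  rw [unit_half, associator_inv_naturality_left_assoc, ← comp_whiskerRight_assoc, unit_half]
  symm
  calc
    _ = 𝟙 _ ⊗≫ X ◁ (I.unit ▷ Y ≫ I.half c) ⊗≫ 𝟙 _ := by monoidal
    _ = _ := by rw [I.unit_half c]; monoidal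

theorem unit_whisker_half :
    I.unit ▷ X ≫ I.half a = ((λ_ X).hom ≫ (ρ_ X).inv) ≫ X ◁ I.unit := by
  rw [unit_half, Category.assoc]

theorem counit_half :
    I.counit ▷ X ≫ (λ_ X).hom ≫ (ρ_ X).inv = I.half a ≫ X ◁ I.counit := by
  refine I.hom_ext_left ((I.lin_counit.whiskerRight _).comp ((Lin.leftUnitor _).comp
    (Lin.rightUnitor_inv _))) ((I.lin_half a).comp (I.lin_counit.whiskerLeft _)) ?_
  rw [reassoc_of% I.unit_half, ← MonoidalCategory.whiskerLeft_comp, ← comp_whiskerRight_assoc,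
    unit_counit]
  simp

theorem comul_half :
    I.comul ▷ X ≫ (α_ _ _ _).hom ≫ I.obj ◁ I.half a ≫ (α_ _ _ _).inv ≫ I.half a ▷ I.obj ≫
      (α_ _ _ _).hom = I.half a ≫ X ◁ I.comul := by
  refine I.hom_ext_left ((I.lin_comul.whiskerRight _).comp ((Lin.assoc _ _ _).comp
    (((I.lin_half a).whiskerLeft _).comp ((Lin.assoc_inv _ _ _).comp
      (((I.lin_half a).whiskerRight _).comp (Lin.assoc _ _ _))))))
    ((I.lin_half a).comp (I.lin_comul.whiskerLeft _)) ?_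
  rw [reassoc_of% I.unit_half, ← MonoidalCategory.whiskerLeft_comp, ← comp_whiskerRight_assoc,
    unit_comul]
  calc
    _ = 𝟙 _ ⊗≫ (I.unit ⊗ₘ I.unit) ▷ X ⊗≫ I.obj ◁ I.half a ⊗≫ I.half a ▷ I.obj ⊗≫ 𝟙 _ := by
      monoidal
    _ = 𝟙 _ ⊗≫ I.unit ▷ X ⊗≫ I.obj ◁ (I.unit ▷ X ≫ I.half a) ⊗≫ I.half a ▷ I.obj ⊗≫ 𝟙 _ := by
      rw [MonoidalCategory.tensorHom_def]; monoidal
    _ = 𝟙 _ ⊗≫ (I.unit ▷ (X ⊗ 𝟙_ C) ≫ I.obj ◁ (X ◁ I.unit)) ⊗≫ I.half a ▷ I.obj ⊗≫ 𝟙 _ := by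
      rw [I.unit_half a]; monoidal
    _ = 𝟙 _ ⊗≫ X ◁ I.unit ⊗≫ (I.unit ▷ X ≫ I.half a) ▷ I.obj ⊗≫ 𝟙 _ := by
      rw [← whisker_exchange]; monoidal
    _ = _ := by
      rw [I.unit_half a, tensorHom_def']; monoidal

theorem mul_half :
    I.mul ▷ X ≫ I.half a = ((α_ _ _ _).hom ≫ I.obj ◁ I.half a ≫ (α_ _ _ _).inv ≫
      I.half a ▷ I.obj ≫ (α_ _ _ _).hom) ≫ X ◁ I.mul := by
  -- Reassociating puts the source in the form `B ⊗ N` required by the uniqueness principle.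
  rw [← cancel_epi (α_ _ _ _).inv]
  -- The second copy of `B` carries the action `ract`, so the half-braiding inside it must be linear
  -- for the actions transported along `P ⟶ T ⟶ P`.
  have hp := (I.lin_half a).pull (f := r.i) |>.pull (f := r.r)
  simp only [pull_tens, pull_pull_retract] at hp
  refine I.hom_ext_left
    ((Lin.assoc_inv _ I.ract _).comp ((I.lin_mul.whiskerRight _).comp (I.lin_half a)))
    ((Lin.assoc_inv _ I.ract _).comp (((Lin.assoc _ _ _).comp ((hp.whiskerLeft _).comp
      ((Lin.assoc_inv _ _ _).comp (((I.lin_half a).whiskerRight _).comp (Lin.assoc _ _ _))))).comp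
        (I.lin_mul.whiskerLeft _))) ?_
  calc
    _ = 𝟙 _ ⊗≫ (I.unit ▷ I.obj ≫ I.mul) ▷ X ⊗≫ I.half a := by monoidal
    _ = 𝟙 _ ⊗≫ I.half a ⊗≫ X ◁ (I.unit ▷ I.obj ≫ I.mul) := by rw [unit_mul]; monoidal
    _ = 𝟙 _ ⊗≫ 𝟙_ C ◁ I.half a ⊗≫ (I.unit ▷ X ≫ I.half a) ▷ I.obj ⊗≫ X ◁ I.mul := by
      rw [I.unit_half a]; monoidal
    _ = 𝟙 _ ⊗≫ (𝟙_ C ◁ I.half a ≫ I.unit ▷ (X ⊗ I.obj)) ⊗≫ I.half a ▷ I.obj ⊗≫ X ◁ I.mul := by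
      monoidal
    _ = _ := by rw [whisker_exchange]; monoidal

end HalfBraiding

/-! ### The bialgebra axioms -/

/-- The product has `g^* f^* B` as its second factor; this lemma supplies linearity of structure
maps applied in that factor. -/
theorem lin_pull_pull {X Y : C} {a : P.obj X ⟶ X} {b : P.obj Y ⟶ Y} {h : X ⟶ Y} (hh : Lin P a b h) :
    Lin P (pull r.r (pull r.i a)) (pull r.r (pull r.i b)) h :=
  hh.pull.pull

/-- The left unit law holds by definition of the product. The right one needs uniqueness, and
becomes on `u` the left unit law. -/
theorem mul_unit : I.obj ◁ I.unit ≫ I.mul = (ρ_ _).hom := by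
  refine I.hom_ext_left ((I.lin_unit_ract.whiskerLeft _).comp I.lin_mul) (Lin.rightUnitor _) ?_
  rw [← whisker_exchange_assoc, unit_mul, rightUnitor_naturality]
  simp [unitors_equal]

theorem mul_assoc : I.mul ▷ I.obj ≫ I.mul = (α_ _ _ _).hom ≫ I.obj ◁ I.mul ≫ I.mul := by
  rw [← cancel_epi (α_ _ _ _).inv, Iso.inv_hom_id_assoc]
  have hm := lin_pull_pull (r := r) I.lin_mul
  simp only [pull_tens, pull_pull_retract] at hm
  refine I.hom_ext_left
    ((Lin.assoc_inv _ I.ract I.ract).comp ((I.lin_mul.whiskerRight _).comp I.lin_mul))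
    ((hm.whiskerLeft _).comp I.lin_mul) ?_
  rw [associator_inv_naturality_left_assoc, ← comp_whiskerRight_assoc, unit_mul,
    ← whisker_exchange_assoc, unit_mul]
  simp

theorem comul_counit : I.comul ≫ I.obj ◁ I.counit = (ρ_ _).inv := by
  refine I.hom_ext (I.lin_comul.comp (I.lin_counit.whiskerLeft _)) (Lin.rightUnitor_inv _) ?_
  rw [reassoc_of% I.unit_comul, MonoidalCategory.tensorHom_def, Category.assoc,
    ← MonoidalCategory.whiskerLeft_comp, unit_counit, unitors_inv_equal]
  simp

theorem counit_comul : I.comul ≫ I.counit ▷ I.obj = (λ_ _).inv := by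
  refine I.hom_ext (I.lin_comul.comp (I.lin_counit.whiskerRight _)) (Lin.leftUnitor_inv _) ?_
  rw [reassoc_of% I.unit_comul, tensorHom_def', Category.assoc, ← comp_whiskerRight, unit_counit]
  simp

theorem comul_assoc :
    I.comul ≫ I.obj ◁ I.comul = I.comul ≫ I.comul ▷ I.obj ≫ (α_ _ _ _).hom := by
  refine I.hom_ext (I.lin_comul.comp (I.lin_comul.whiskerLeft _))
    (I.lin_comul.comp ((I.lin_comul.whiskerRight _).comp (Lin.assoc _ _ _))) ?_
  rw [reassoc_of% I.unit_comul, reassoc_of% I.unit_comul]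
  calc
    _ = (λ_ (𝟙_ C)).inv ≫ I.unit ▷ _ ≫ I.obj ◁ (I.unit ≫ I.comul) := by
      rw [MonoidalCategory.tensorHom_def]; simp
    _ = 𝟙 _ ⊗≫ (I.unit ▷ (𝟙_ C ⊗ 𝟙_ C) ≫ I.obj ◁ (I.unit ⊗ₘ I.unit)) := by
      rw [unit_comul]; monoidal
    _ = 𝟙 _ ⊗≫ (I.unit ⊗ₘ (I.unit ⊗ₘ I.unit)) := by rw [← MonoidalCategory.tensorHom_def]
    _ = 𝟙 _ ⊗≫ ((I.unit ⊗ₘ I.unit) ⊗ₘ I.unit) ⊗≫ 𝟙 _ := by monoidal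
    _ = (λ_ (𝟙_ C)).inv ≫ _ ◁ I.unit ≫ (I.unit ≫ I.comul) ▷ I.obj ≫ (α_ _ _ _).hom := by
      rw [unit_comul, tensorHom_def']; monoidal
    _ = _ := by rw [tensorHom_def']; simp

theorem mul_counit : I.mul ≫ I.counit = (I.counit ⊗ₘ I.counit) ≫ (λ_ (𝟙_ C)).hom := by
  have hc := lin_pull_pull (r := r) I.lin_counit
  simp only [pull_unitAct] at hc
  refine I.hom_ext_left (I.lin_mul.comp I.lin_counit)
    ((I.lin_counit.tensor hc).comp (Lin.leftUnitor _)) ?_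
  rw [reassoc_of% I.unit_mul, MonoidalCategory.tensorHom_def, Category.assoc,
    ← comp_whiskerRight_assoc, unit_counit]
  simp

/-- After `Δ ⊗ Δ` the four factors carry the actions `act`, `act`, `ract`, `ract`. The half-braiding
of the middle two yields `act`, `ract`, `act`, `ract`, as `m ⊗ m` requires. Thus both sides are
`P`-linear and are compared on `u ⊗ B`, where both give the coproduct of the second factor. -/
theorem mul_comul : I.mul ≫ I.comul = (I.comul ⊗ₘ I.comul) ≫
    ((α_ _ _ _).hom ≫ (I.obj ◁ (α_ _ _ _).inv) ≫ (I.obj ◁ I.half I.tact ▷ I.obj) ≫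
      (I.obj ◁ (α_ _ _ _).hom) ≫ (α_ _ _ _).inv) ≫ (I.mul ⊗ₘ I.mul) := by
  have hc := lin_pull_pull (r := r) I.lin_comul
  simp only [pull_tens] at hc
  refine I.hom_ext_left (I.lin_mul.comp I.lin_comul)
    ((I.lin_comul.tensor hc).comp (((Lin.assoc _ _ _).comp (((Lin.assoc_inv _ _ _).whiskerLeft
      _).comp ((((I.lin_half _).whiskerRight _).whiskerLeft _).comp (((Lin.assoc _ _ _).whiskerLeft
        _).comp (Lin.assoc_inv _ _ _))))).comp (I.lin_mul.tensor I.lin_mul))) ?_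
  rw [reassoc_of% I.unit_mul]
  symm
  calc
    _ = 𝟙_ C ◁ I.comul ≫ (I.unit ≫ I.comul) ▷ (I.obj ⊗ I.obj) ⊗≫
        I.obj ◁ I.half I.tact ▷ I.obj ⊗≫ (I.mul ⊗ₘ I.mul) := by
      rw [tensorHom_def' I.comul I.comul, Category.assoc, ← whisker_exchange_assoc]
      monoidal
    _ = 𝟙_ C ◁ I.comul ⊗≫ I.unit ▷ (I.obj ⊗ I.obj) ⊗≫
        I.obj ◁ (I.unit ▷ I.obj ≫ I.half I.tact) ▷ I.obj ⊗≫ (I.mul ⊗ₘ I.mul) := by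
      rw [unit_comul, MonoidalCategory.tensorHom_def I.unit]; monoidal
    _ = 𝟙_ C ◁ I.comul ⊗≫ I.unit ▷ (I.obj ⊗ I.obj) ⊗≫
        I.obj ◁ I.obj ◁ (I.unit ▷ I.obj ≫ I.mul) ⊗≫ I.mul ▷ I.obj := by
      rw [I.unit_half I.tact, tensorHom_def']; monoidal
    _ = 𝟙_ C ◁ I.comul ⊗≫ (I.unit ▷ I.obj ≫ I.mul) ▷ I.obj := by
      nth_rw 1 [unit_mul]; monoidal
    _ = _ := by rw [unit_mul]; monoidal

theorem lin_mul_tact : Lin T (T.tens I.tact I.tact) I.tact I.mul := by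
  have h := I.lin_mul.pull (f := r.i)
  rwa [pull_tens, pull_pull_retract] at h

theorem lin_comul_tact : Lin T I.tact (T.tens I.tact I.tact) I.comul := by
  have h := I.lin_comul.pull (f := r.i)
  rwa [pull_tens] at h

theorem lin_counit_tact : Lin T I.tact T.unitAct I.counit := by
  have h := I.lin_counit.pull (f := r.i)
  rwa [pull_unitAct] at h

theorem lin_half_tact {X : C} (a : T.obj X ⟶ X) [IsAct T a] :
    Lin T (T.tens I.tact a) (T.tens a I.tact) (I.half a) := by
  have h := (I.lin_half a).pull (f := r.i)
  rwa [pull_tens, pull_tens, pull_pull_retract] at h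

/-! ### The antipode -/

/-- The morphism `S(a) b`, defined by its universal property. -/
noncomputable def leftDiv : I.obj ⊗ I.obj ⟶ I.obj :=
  -- Compared with the product, the actions `act` and `ract` on the second factor and on the target
  -- are exchanged.
  I.liftLeft I.act I.ract (𝟙 _) (by rw [pull_pull_retract]; exact Lin.id _)

theorem lin_leftDiv : Lin P (P.tens I.act I.act) I.ract I.leftDiv := I.lin_liftLeft _ _ _ _

theorem unit_leftDiv : I.unit ▷ I.obj ≫ I.leftDiv = (λ_ _).hom := by
  rw [leftDiv, unit_liftLeft, Category.comp_id]

/-- The morphism `S⁻¹(b) a`, defined by its universal property. -/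
noncomputable def rightDiv : I.obj ⊗ I.obj ⟶ I.obj :=
  I.liftRight I.act I.ract (𝟙 _) (by rw [pull_pull_retract]; exact Lin.id _)

theorem lin_rightDiv : Lin P (P.tens I.act I.act) I.ract I.rightDiv := I.lin_liftRight _ _ _ _

theorem unit_rightDiv : I.obj ◁ I.unit ≫ I.rightDiv = (ρ_ _).hom := by
  rw [rightDiv, unit_liftRight, Category.comp_id]

/-- The antipode. -/
noncomputable def antipode : I.obj ⟶ I.obj := (ρ_ _).inv ≫ I.obj ◁ I.unit ≫ I.leftDiv

/-- The inverse of the antipode. -/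
noncomputable def antipodeInv : I.obj ⟶ I.obj := (λ_ _).inv ≫ I.unit ▷ I.obj ≫ I.rightDiv

theorem lin_antipode : Lin T I.tact I.tact I.antipode := by
  have h := I.lin_leftDiv.pull (f := r.i)
  rw [pull_tens, pull_pull_retract] at h
  exact (Lin.rightUnitor_inv _).comp ((I.lin_unit.whiskerLeft _).comp h)

theorem lin_antipodeInv : Lin T I.tact I.tact I.antipodeInv := by
  have h := I.lin_rightDiv.pull (f := r.i)
  rw [pull_tens, pull_pull_retract] at h
  exact (Lin.leftUnitor_inv _).comp ((I.lin_unit.whiskerRight _).comp h)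

/-- Heuristically `S⁻¹(S(a) b) = S⁻¹(b) a`. Both sides are `P`-linear, and on `a = u` both reduce to
`S⁻¹(b)`. With the mirror identity below, this gives that the antipode is invertible. -/
theorem leftDiv_antipodeInv : I.leftDiv ≫ I.antipodeInv = I.rightDiv := by
  refine I.hom_ext_left (I.lin_leftDiv.comp I.lin_antipodeInv.pull) I.lin_rightDiv ?_
  rw [reassoc_of% I.unit_leftDiv, antipodeInv, Iso.hom_inv_id_assoc]

theorem rightDiv_antipode : I.rightDiv ≫ I.antipode = I.leftDiv := by
  refine I.hom_ext_right (I.lin_rightDiv.comp I.lin_antipode.pull) I.lin_leftDiv ?_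
  rw [reassoc_of% I.unit_rightDiv, antipode, Iso.hom_inv_id_assoc]

theorem antipode_antipodeInv : I.antipode ≫ I.antipodeInv = 𝟙 _ := by
  rw [antipode, Category.assoc, Category.assoc, leftDiv_antipodeInv, unit_rightDiv,
    Iso.inv_hom_id]

theorem antipodeInv_antipode : I.antipodeInv ≫ I.antipode = 𝟙 _ := by
  rw [antipodeInv, Category.assoc, Category.assoc, rightDiv_antipode, unit_leftDiv,
    Iso.inv_hom_id]

/-- This is `S(a₁) a₂ = ε(a) 1`: both sides are `P`-linear into `g^* f^* B`, and both send `u` to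
`u`. -/
theorem comul_leftDiv : I.comul ≫ I.leftDiv = I.counit ≫ I.unit := by
  refine I.hom_ext (I.lin_comul.comp I.lin_leftDiv) (I.lin_counit.comp I.lin_unit_ract) ?_
  rw [reassoc_of% I.unit_comul, reassoc_of% I.unit_counit, tensorHom_def', Category.assoc,
    unit_leftDiv]
  simp

/-- The identity `(S(a) b) c = S(a) (b c)`, checked at `a = u`. Setting `b = u` shows that the
division map is indeed multiplication by the antipode. -/
theorem leftDiv_mul :
    I.leftDiv ▷ I.obj ≫ I.mul = (α_ _ _ _).hom ≫ I.obj ◁ I.mul ≫ I.leftDiv := by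
  rw [← cancel_epi (α_ _ _ _).inv, Iso.inv_hom_id_assoc]
  have hm := lin_pull_pull (r := r) I.lin_mul
  simp only [pull_tens, pull_pull_retract] at hm
  refine I.hom_ext_left
    ((Lin.assoc_inv _ I.act I.ract).comp ((I.lin_leftDiv.whiskerRight _).comp hm))
    ((I.lin_mul.whiskerLeft _).comp I.lin_leftDiv) ?_
  rw [associator_inv_naturality_left_assoc, ← comp_whiskerRight_assoc, unit_leftDiv,
    ← whisker_exchange_assoc, unit_leftDiv]
  simp

theorem antipode_mul : I.antipode ▷ I.obj ≫ I.mul = I.leftDiv := by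
  rw [antipode, comp_whiskerRight, comp_whiskerRight, Category.assoc, Category.assoc, leftDiv_mul]
  calc
    _ = 𝟙 _ ⊗≫ I.obj ◁ (I.unit ▷ I.obj ≫ I.mul) ⊗≫ I.leftDiv := by monoidal
    _ = _ := by rw [unit_mul]; monoidal

theorem antipode_left : I.comul ≫ I.antipode ▷ I.obj ≫ I.mul = I.counit ≫ I.unit := by
  rw [antipode_mul, comul_leftDiv]

/-- The identity `a₁ (S(a₂) b) = ε(a) b`. The free variable `b` keeps both sides `P`-linear:
linearity of the antipode itself is established only over `T`, so the right antipode axiom is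
obtained afterwards by setting `b = u`. -/
theorem comul_leftDiv_mul :
    I.comul ▷ I.obj ≫ (α_ _ _ _).hom ≫ I.obj ◁ I.leftDiv ≫ I.mul =
      I.counit ▷ I.obj ≫ (λ_ _).hom := by
  refine I.hom_ext_left ((I.lin_comul.whiskerRight _).comp ((Lin.assoc _ _ _).comp
    ((I.lin_leftDiv.whiskerLeft _).comp I.lin_mul)))
    ((I.lin_counit.whiskerRight I.act).comp (Lin.leftUnitor _)) ?_
  rw [← comp_whiskerRight_assoc, ← comp_whiskerRight_assoc, unit_comul, unit_counit]
  calc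
    _ = 𝟙 _ ⊗≫ I.unit ▷ (𝟙_ C ⊗ I.obj) ⊗≫ I.obj ◁ (I.unit ▷ I.obj ≫ I.leftDiv) ≫ I.mul := by
      rw [MonoidalCategory.tensorHom_def]; monoidal
    _ = 𝟙 _ ⊗≫ (I.unit ▷ I.obj ≫ I.mul) := by rw [unit_leftDiv]; monoidal
    _ = _ := by rw [unit_mul]; monoidal

theorem antipode_right : I.comul ≫ I.obj ◁ I.antipode ≫ I.mul = I.counit ≫ I.unit := by
  calc
    _ = 𝟙 _ ⊗≫ (I.comul ▷ 𝟙_ C ≫ (I.obj ⊗ I.obj) ◁ I.unit) ⊗≫ I.obj ◁ I.leftDiv ≫ I.mul := by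
      rw [antipode]; monoidal
    _ = 𝟙 _ ⊗≫ I.obj ◁ I.unit ≫ (I.comul ▷ I.obj ≫ (α_ _ _ _).hom ≫ I.obj ◁ I.leftDiv ≫
        I.mul) := by
      rw [← whisker_exchange]; monoidal
    _ = 𝟙 _ ⊗≫ (I.obj ◁ I.unit ≫ I.counit ▷ I.obj) ⊗≫ 𝟙 _ := by
      rw [comul_leftDiv_mul]; monoidal
    _ = _ := by rw [whisker_exchange]; monoidal

section

variable {X : C} (a : T.obj X ⟶ X) [IsAct T a]

theorem leftDiv_half :
    I.leftDiv ▷ X ≫ I.half a = ((α_ _ _ _).hom ≫ I.obj ◁ I.half a ≫ (α_ _ _ _).inv ≫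
      I.half a ▷ I.obj ≫ (α_ _ _ _).hom) ≫ X ◁ I.leftDiv := by
  rw [← cancel_epi (α_ _ _ _).inv]
  have hp := lin_pull_pull (r := r) (I.lin_half a)
  simp only [pull_tens, pull_pull_retract] at hp
  refine I.hom_ext_left
    ((Lin.assoc_inv _ I.act _).comp ((I.lin_leftDiv.whiskerRight _).comp hp))
    ((Lin.assoc_inv _ I.act _).comp (((Lin.assoc _ _ _).comp (((I.lin_half a).whiskerLeft _).comp
      ((Lin.assoc_inv _ _ _).comp (((I.lin_half a).whiskerRight _).comp (Lin.assoc _ _ _))))).comp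
        (I.lin_leftDiv.whiskerLeft _))) ?_
  calc
    _ = 𝟙 _ ⊗≫ (I.unit ▷ I.obj ≫ I.leftDiv) ▷ X ⊗≫ I.half a := by monoidal
    _ = 𝟙 _ ⊗≫ I.half a ⊗≫ X ◁ (I.unit ▷ I.obj ≫ I.leftDiv) := by rw [unit_leftDiv]; monoidal
    _ = 𝟙 _ ⊗≫ 𝟙_ C ◁ I.half a ⊗≫ (I.unit ▷ X ≫ I.half a) ▷ I.obj ⊗≫ X ◁ I.leftDiv := by
      rw [I.unit_half a]; monoidal
    _ = 𝟙 _ ⊗≫ (𝟙_ C ◁ I.half a ≫ I.unit ▷ (X ⊗ I.obj)) ⊗≫ I.half a ▷ I.obj ⊗≫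
        X ◁ I.leftDiv := by
      monoidal
    _ = _ := by rw [whisker_exchange]; monoidal

/-- The antipode is division evaluated at `u` in its second variable, and `u` passes through the
half-braiding; compatibility of division with the half-braiding therefore suffices. -/
theorem antipode_half : I.antipode ▷ X ≫ I.half a = I.half a ≫ X ◁ I.antipode := by
  rw [antipode, comp_whiskerRight, comp_whiskerRight, Category.assoc, Category.assoc, leftDiv_half]
  calc
    _ = 𝟙 _ ⊗≫ I.obj ◁ (I.unit ▷ X ≫ I.half a) ⊗≫ I.half a ▷ I.obj ⊗≫ X ◁ I.leftDiv := by
      monoidal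
    _ = 𝟙 _ ⊗≫ ((I.obj ⊗ X) ◁ I.unit ≫ I.half a ▷ I.obj) ⊗≫ X ◁ I.leftDiv := by
      rw [I.unit_half a]; monoidal
    _ = _ := by rw [whisker_exchange]; monoidal

end

/-! ### The comparison of `P` with `B ⊗ T` -/

/-- The comparison morphism `P X ⟶ B ⊗ T X`. -/
def comparison (X : C) : P.obj X ⟶ I.obj ⊗ T.obj X :=
  P.map ((λ_ X).inv ≫ (I.unit ⊗ₘ T.unitApp X)) ≫ P.tens I.act (pull r.r (T.prodApp X))

theorem lin_comparison (X : C) : Lin P (P.prodApp X) (P.tens I.act (pull r.r (T.prodApp X)))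
    (I.comparison X) :=
  Lin.extend (modOf P (P.tens I.act (pull r.r (T.prodApp X)))) _

theorem unit_comparison (X : C) :
    P.unitApp X ≫ I.comparison X = (λ_ X).inv ≫ (I.unit ⊗ₘ T.unitApp X) :=
  unitApp_extend (modOf P (P.tens I.act (pull r.r (T.prodApp X)))) _

/-- The inverse of the comparison morphism. -/
noncomputable def comparisonInv (X : C) : I.obj ⊗ T.obj X ⟶ P.obj X :=
  -- The inverse extends `f_X : T X ⟶ P X`, linear from the free `T`-module to the restricted free
  -- `P`-module.
  I.liftLeft (pull r.r (T.prodApp X)) (P.prodApp X) (r.i.app X) (by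
    rw [pull_pull_retract]; exact lin_app r.i X)

theorem lin_comparisonInv (X : C) : Lin P (P.tens I.act (pull r.r (T.prodApp X))) (P.prodApp X)
    (I.comparisonInv X) :=
  I.lin_liftLeft _ _ _ _

theorem unit_comparisonInv (X : C) :
    I.unit ▷ T.obj X ≫ I.comparisonInv X = (λ_ _).hom ≫ r.i.app X :=
  I.unit_liftLeft _ _ _ _

/-- Both sides are `T`-linear on the free module `T X` and agree on the unit. This serves both for
invertibility of the comparison and for `φ f = ι`. -/
theorem app_comparison (X : C) :
    r.i.app X ≫ I.comparison X = (λ_ (T.obj X)).inv ≫ I.unit ▷ T.obj X := by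
  have h := (I.lin_comparison X).pull (f := r.i)
  rw [pull_tens, pull_pull_retract] at h
  refine Lin.free_ext ((lin_app r.i X).comp h)
    ((Lin.leftUnitor_inv _).comp (I.lin_unit.whiskerRight _)) ?_
  rw [← Category.assoc, unitApp_app, unit_comparison, tensorHom_def']
  simp

theorem comparison_comparisonInv (X : C) : I.comparison X ≫ I.comparisonInv X = 𝟙 _ := by
  refine Lin.free_ext ((I.lin_comparison X).comp (I.lin_comparisonInv X)) (Lin.id _) ?_
  rw [reassoc_of% I.unit_comparison, tensorHom_def', Category.assoc, unit_comparisonInv,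
    ← unitApp_app r.i]
  simp

theorem comparisonInv_comparison (X : C) : I.comparisonInv X ≫ I.comparison X = 𝟙 _ := by
  refine I.hom_ext_left ((I.lin_comparisonInv X).comp (I.lin_comparison X)) (Lin.id _) ?_
  rw [reassoc_of% I.unit_comparisonInv, app_comparison, Iso.hom_inv_id_assoc, Category.comp_id]

theorem comparison_naturality {X Y : C} (h : X ⟶ Y) :
    P.map h ≫ I.comparison Y = I.comparison X ≫ I.obj ◁ T.map h := by
  refine Lin.free_ext ((Lin.free_map h).comp (I.lin_comparison Y))
    ((I.lin_comparison X).comp ((Lin.free_map h).pull.whiskerLeft _)) ?_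
  rw [← Category.assoc, ← P.unitApp_naturality, Category.assoc, unit_comparison,
    reassoc_of% I.unit_comparison, tensorHom_def', tensorHom_def', Category.assoc,
    ← whisker_exchange, ← MonoidalCategory.whiskerLeft_comp_assoc, ← T.unitApp_naturality]
  simp

/-- The right side is the product of the cross product: `T` acts diagonally on `B ⊗ T X`, then the
two copies of `B` are multiplied. On the generators of `P (P X)` the unit of `T` cancels the action
and `u` cancels the multiplication. -/
theorem comparison_prod (X : C) : P.prodApp X ≫ I.comparison X =
    (P.map (I.comparison X) ≫ I.comparison (I.obj ⊗ T.obj X)) ≫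
      I.obj ◁ T.tens I.tact (T.prodApp X) ≫ (α_ _ _ _).inv ≫ I.mul ▷ T.obj X := by
  have h := (Lin.action (modOf T (T.tens I.tact (T.prodApp X)))).pull (f := r.r)
  rw [pull_tens] at h
  refine Lin.free_ext ((Lin.action (P.freeMod X)).comp (I.lin_comparison X))
    (((Lin.free_map _).comp (I.lin_comparison _)).comp ((h.whiskerLeft _).comp
      ((Lin.assoc_inv _ _ _).comp (I.lin_mul.whiskerRight _)))) ?_
  have e := unit_act (modOf T (T.tens I.tact (T.prodApp X)))
  have e1 := P.unitApp_naturality (I.comparison X)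
  rw [← Category.assoc, unitApp_prodApp, Category.id_comp, Category.assoc, ← reassoc_of% e1,
    reassoc_of% I.unit_comparison, MonoidalCategory.tensorHom_def, Category.assoc,
    ← MonoidalCategory.whiskerLeft_comp_assoc, e]
  symm
  calc
    _ = I.comparison X ⊗≫ (I.unit ▷ I.obj ≫ I.mul) ▷ T.obj X := by monoidal
    _ = _ := by rw [unit_mul]; monoidal

/-- Both sides are linear on the free module on `X ⊗ Y`. On generators, `Δ` gives `u ⊗ u` and the
half-braiding moves the second `u` past `T X`, giving `(u ⊗ η_X) ⊗ (u ⊗ η_Y)`. -/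
theorem comparison_δ (X Y : C) :
    I.comparison (X ⊗ Y) ≫ I.obj ◁ δ T.toFunctor X Y ≫ I.comul ▷ (T.obj X ⊗ T.obj Y) ≫
      (α_ _ _ _).hom ≫ I.obj ◁ (α_ _ _ _).inv ≫ I.obj ◁ I.half (T.prodApp X) ▷ T.obj Y ≫
        I.obj ◁ (α_ _ _ _).hom ≫ (α_ _ _ _).inv =
      δ P.toFunctor X Y ≫ (I.comparison X ⊗ₘ I.comparison Y) := by
  have hP : Lin P (P.prodApp (X ⊗ Y)) (P.tens (P.prodApp X) (P.prodApp Y)) (δ P.toFunctor X Y) :=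
    (P.prodApp_δ X Y).symm
  have hT : Lin T (T.prodApp (X ⊗ Y)) (T.tens (T.prodApp X) (T.prodApp Y)) (δ T.toFunctor X Y) :=
    (T.prodApp_δ X Y).symm
  have hT' := hT.pull (f := r.r)
  rw [pull_tens] at hT'
  refine Lin.free_ext ((I.lin_comparison (X ⊗ Y)).comp ((hT'.whiskerLeft _).comp
    ((I.lin_comul.whiskerRight _).comp ((Lin.assoc _ _ _).comp (((Lin.assoc_inv _ _ _).whiskerLeft
      _).comp ((((I.lin_half _).whiskerRight _).whiskerLeft _).comp (((Lin.assoc _ _ _).whiskerLeft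
        _).comp (Lin.assoc_inv _ _ _))))))))
    (hP.comp ((I.lin_comparison X).tensor (I.lin_comparison Y))) ?_
  rw [reassoc_of% P.unitApp_δ, tensorHom_comp_tensorHom, unit_comparison, unit_comparison,
    reassoc_of% I.unit_comparison, tensorHom_def', Category.assoc,
    ← whisker_exchange_assoc, ← MonoidalCategory.whiskerLeft_comp_assoc, unitApp_δ,
    ← comp_whiskerRight_assoc, unit_comul]
  calc
    _ = 𝟙 _ ⊗≫ (T.unitApp X ⊗ₘ T.unitApp Y) ⊗≫ I.unit ▷ T.obj X ▷ T.obj Y ⊗≫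
        I.obj ◁ (I.unit ▷ T.obj X ≫ I.half (T.prodApp X)) ▷ T.obj Y ⊗≫ 𝟙 _ := by
      rw [MonoidalCategory.tensorHom_def I.unit]; monoidal
    _ = (T.unitApp X ⊗ₘ T.unitApp Y) ≫ (((λ_ _).inv ≫ I.unit ▷ T.obj X) ⊗ₘ
        ((λ_ _).inv ≫ I.unit ▷ T.obj Y)) := by
      rw [I.unit_half (T.prodApp X), MonoidalCategory.tensorHom_def ((λ_ (T.obj X)).inv ≫ _)]
      monoidal
    _ = _ := by
      rw [tensorHom_comp_tensorHom, leftUnitor_inv_naturality_assoc,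
        leftUnitor_inv_naturality_assoc, ← tensorHom_def', ← tensorHom_def']

theorem comparison_counit :
    I.comparison (𝟙_ C) ≫ I.obj ◁ T.unitAct ≫ (ρ_ _).hom ≫ I.counit = P.unitAct := by
  have h := (lin_unitAct T).pull (f := r.r)
  rw [pull_unitAct] at h
  refine Lin.free_ext ((I.lin_comparison _).comp ((h.whiskerLeft _).comp ((Lin.rightUnitor _).comp
    I.lin_counit))) (lin_unitAct P) ?_
  rw [reassoc_of% I.unit_comparison, MonoidalCategory.tensorHom_def, Category.assoc,
    ← MonoidalCategory.whiskerLeft_comp_assoc, unitApp_counit, unitApp_counit,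
    MonoidalCategory.whiskerLeft_id, Category.id_comp, rightUnitor_naturality_assoc, unit_counit,
    unitors_inv_equal]
  simp

/-- Both sides are linear from `P X` to `g^* (T X)` and restrict to the unit of `T` on `X`; this
becomes `π φ = g`. -/
theorem comparison_counit_whiskerRight (X : C) :
    I.comparison X ≫ I.counit ▷ T.obj X ≫ (λ_ _).hom = r.r.app X := by
  refine Lin.free_ext ((I.lin_comparison _).comp ((I.lin_counit.whiskerRight _).comp
    (Lin.leftUnitor _))) (lin_app r.r X) ?_
  rw [reassoc_of% I.unit_comparison, tensorHom_def', Category.assoc, ← comp_whiskerRight_assoc,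
    unit_counit, unitApp_app]
  simp

end InducedUnit

/-- The morphism of modules defined by a linear morphism. -/
abbrev Lin.toHom {M N : T.Mod} {h : M.A ⟶ N.A} (hh : Lin T M.a N.a h) : M ⟶ N := ⟨h, hh⟩

namespace InducedUnit

variable {r : Retract T P} (I : InducedUnit r.i)

/-! ### The central Hopf algebra -/

/-- The induced module, as a `T`-module. -/
abbrev tmod : T.Mod := res r.i I.mod

/-- The half-braiding of the induced module with a `T`-module. -/
noncomputable def halfIso (M : T.Mod) : I.tmod ⊗ M ≅ M ⊗ I.tmod where
  hom := Lin.toHom (M := I.tmod ⊗ M) (N := M ⊗ I.tmod) (I.lin_half_tact M.a)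
  inv := Lin.toHom (M := M ⊗ I.tmod) (N := I.tmod ⊗ M)
    ((I.lin_half_tact M.a).inv (I.half_halfInv M.a) (I.halfInv_half M.a))
  hom_inv_id := Monad.Algebra.Hom.ext (I.half_halfInv M.a)
  inv_hom_id := Monad.Algebra.Hom.ext (I.halfInv_half M.a)

/-- The induced module, as an object of the center of the category of `T`-modules. -/
noncomputable def central : Center T.Mod :=
  ⟨I.tmod,
    { β := I.halfIso
      monoidal := fun M N => Monad.Algebra.Hom.ext (I.half_tens M.a N.a)
      naturality := fun h => Monad.Algebra.Hom.ext (I.half_naturality (Lin.mod_hom h)) }⟩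

noncomputable instance : MonObj I.central where
  one := ⟨Lin.toHom (M := 𝟙_ T.Mod) (N := I.tmod) I.lin_unit,
    fun M => Monad.Algebra.Hom.ext (I.unit_whisker_half M.a)⟩
  mul := ⟨Lin.toHom (M := I.tmod ⊗ I.tmod) (N := I.tmod) I.lin_mul_tact,
    fun M => Monad.Algebra.Hom.ext (I.mul_half M.a)⟩
  one_mul := Center.ext _ _ (Monad.Algebra.Hom.ext I.unit_mul)
  mul_one := Center.ext _ _ (Monad.Algebra.Hom.ext I.mul_unit)
  mul_assoc := Center.ext _ _ (Monad.Algebra.Hom.ext I.mul_assoc)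

noncomputable instance : ComonObj I.central where
  counit := ⟨Lin.toHom (M := I.tmod) (N := 𝟙_ T.Mod) I.lin_counit_tact,
    fun M => Monad.Algebra.Hom.ext (I.counit_half M.a)⟩
  comul := ⟨Lin.toHom (M := I.tmod) (N := I.tmod ⊗ I.tmod) I.lin_comul_tact,
    fun M => Monad.Algebra.Hom.ext (I.comul_half M.a)⟩
  counit_comul := Center.ext _ _ ((Monad.Algebra.Hom.ext I.counit_comul :
    _ = (λ_ I.tmod).inv).trans (Center.leftUnitor_inv_f I.central).symm)
  comul_counit := Center.ext _ _ ((Monad.Algebra.Hom.ext I.comul_counit :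
    _ = (ρ_ I.tmod).inv).trans (Center.rightUnitor_inv_f I.central).symm)
  comul_assoc := Center.ext _ _ (Monad.Algebra.Hom.ext I.comul_assoc)

noncomputable instance : BimonObj I.central where
  one_comul := Center.ext _ _ ((Monad.Algebra.Hom.ext I.unit_comul).trans
    (congrArg (· ≫ (_ ⊗ₘ _)) (Center.leftUnitor_inv_f (𝟙_ (Center T.Mod))).symm))
  mul_counit := Center.ext _ _ (Monad.Algebra.Hom.ext I.mul_counit)
  one_counit := Center.ext _ _ (Monad.Algebra.Hom.ext I.unit_counit)
  mul_comul := by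
    apply Center.ext
    have e1 := Center.associator_inv_f I.central I.central I.central
    have e2 := Center.associator_inv_f I.central I.central (I.central ⊗ I.central)
    simp only [tensorμ, Center.comp_f, Center.whiskerLeft_f, e1, e2]
    exact Monad.Algebra.Hom.ext I.mul_comul

noncomputable instance : HopfObj I.central where
  antipode := ⟨Lin.toHom (M := I.tmod) (N := I.tmod) I.lin_antipode,
    fun M => Monad.Algebra.Hom.ext (I.antipode_half M.a)⟩
  antipode_left := Center.ext _ _ (Monad.Algebra.Hom.ext I.antipode_left)
  antipode_right := Center.ext _ _ (Monad.Algebra.Hom.ext I.antipode_right)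

theorem isIso_antipode : IsIso (HopfObj.antipode : I.central ⟶ I.central) := by
  have : IsIso (HopfObj.antipode : I.central ⟶ I.central).f :=
    ⟨Lin.toHom (M := I.tmod) (N := I.tmod) I.lin_antipodeInv,
      Monad.Algebra.Hom.ext I.antipode_antipodeInv, Monad.Algebra.Hom.ext I.antipodeInv_antipode⟩
  -- An isomorphism of underlying `T`-modules that is a morphism of the center is an isomorphism
  -- there.
  infer_instance

/-! ### The isomorphism with the cross product -/

/-- The comparison morphism of bimonads. -/
noncomputable def bosonHom : P ⟶ boson T I.central :=
  { app := I.comparison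
    naturality := fun X Y h => I.comparison_naturality h
    app_η := fun X => (I.unit_comparison X).trans (by
      change _ = T.unitApp X ≫ (λ_ (T.obj X)).inv ≫ I.unit ▷ T.obj X
      rw [tensorHom_def']
      simp)
    app_μ := I.comparison_prod
    app_δ := fun X Y => I.comparison_δ X Y
    app_counit := I.comparison_counit }

end InducedUnit

/-! ### Isomorphisms of bimonads and transport of the Hopf property -/

/-- A morphism of bimonads with invertible components is an isomorphism. -/
def isoOfComponents (φ : T ⟶ P) (ψ : ∀ X, P.obj X ⟶ T.obj X) (h : ∀ X, φ.app X ≫ ψ X = 𝟙 _)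
    (h' : ∀ X, ψ X ≫ φ.app X = 𝟙 _) : T ≅ P :=
  have hi (X : C) : IsIso (φ.app X) := ⟨ψ X, h X, h' X⟩
  { hom := φ
    inv :=
      { app := ψ
        naturality := fun X Y k => by
          rw [← cancel_mono (φ.app Y), Category.assoc, Category.assoc, h', Category.comp_id,
            app_naturality φ k, reassoc_of% (h' X)]
        app_η := fun X => by
          rw [← cancel_mono (φ.app X), Category.assoc, h', φ.app_η, Category.comp_id]
        app_μ := fun X => by
          have e := prodApp_app φ X
          change P.prodApp X ≫ ψ X = (P.map (ψ X) ≫ ψ (T.obj X)) ≫ T.prodApp X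
          -- Precomposing with the invertible components of `φ` turns the claim into the
          -- multiplicativity of `φ`.
          rw [← cancel_epi (P.map (φ.app X)), ← cancel_epi (φ.app (T.obj X)), ← reassoc_of% e, h,
            ← Category.assoc (P.map _), ← Category.assoc (P.map _), ← Functor.map_comp, h,
            Functor.map_id, Category.id_comp, reassoc_of% (h (T.obj X)), Category.comp_id]
        app_δ := fun X Y => by
          rw [← cancel_epi (φ.app (X ⊗ Y)), reassoc_of% (h _), reassoc_of% φ.app_δ,
            tensorHom_comp_tensorHom, h, h, id_tensorHom_id, Category.comp_id]
        app_counit := by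
          rw [← cancel_epi (φ.app _), reassoc_of% (h _), φ.app_counit] }
    hom_inv_id := hom_ext h
    inv_hom_id := hom_ext h' }

/-- The Hopf property is invariant under isomorphisms of bimonads. -/
theorem IsHopf.of_iso (hT : T.IsHopf) (e : T ≅ P) : P.IsHopf := by
  have hi (X : C) : IsIso (e.hom.app X) := ⟨e.inv.app X,
    by rw [← comp_app, e.hom_inv_id, id_app], by rw [← comp_app, e.inv_hom_id, id_app]⟩
  have hμ (X : C) : e.hom.app (T.obj X) ≫ P.map (e.hom.app X) ≫ P.μ.app X =
      T.μ.app X ≫ e.hom.app X := (prodApp_app e.hom X).symm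
  have hδ := e.hom.app_δ
  constructor
  · intro X Y
    -- The isomorphism intertwines the two fusion operators, so one is invertible when the other is.
    have h : (e.hom.app (X ⊗ T.obj Y) ≫ P.map (X ◁ e.hom.app Y)) ≫ P.leftFusion X Y =
        T.leftFusion X Y ≫ (e.hom.app X ⊗ₘ e.hom.app Y) := by
      unfold leftFusion
      rw [Category.assoc, ← reassoc_of% δ_natural_right, reassoc_of% hδ, Category.assoc,
        ← MonoidalCategory.whiskerLeft_comp, ← id_tensorHom, ← id_tensorHom,
        tensorHom_comp_tensorHom, tensorHom_comp_tensorHom, hμ, Category.comp_id, Category.id_comp]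
    have := hT.isIso_leftFusion X Y
    have h2 : IsIso ((e.hom.app (X ⊗ T.obj Y) ≫ P.map (X ◁ e.hom.app Y)) ≫ P.leftFusion X Y) := by
      rw [h]; infer_instance
    exact IsIso.of_isIso_comp_left (e.hom.app (X ⊗ T.obj Y) ≫ P.map (X ◁ e.hom.app Y)) _
  · intro X Y
    have h : (e.hom.app (T.obj X ⊗ Y) ≫ P.map (e.hom.app X ▷ Y)) ≫ P.rightFusion X Y =
        T.rightFusion X Y ≫ (e.hom.app X ⊗ₘ e.hom.app Y) := by
      unfold rightFusion
      rw [Category.assoc, ← reassoc_of% δ_natural_left, reassoc_of% hδ, Category.assoc,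
        ← comp_whiskerRight, ← tensorHom_id, ← tensorHom_id,
        tensorHom_comp_tensorHom, tensorHom_comp_tensorHom, hμ, Category.comp_id, Category.id_comp]
    have := hT.isIso_rightFusion X Y
    have h2 : IsIso ((e.hom.app (T.obj X ⊗ Y) ≫ P.map (e.hom.app X ▷ Y)) ≫ P.rightFusion X Y) := by
      rw [h]; infer_instance
    exact IsIso.of_isIso_comp_left (e.hom.app (T.obj X ⊗ Y) ≫ P.map (e.hom.app X ▷ Y)) _

end CategoryTheory.Bimonad

theorem mainTheorem4 {C : Type u} [Category.{v} C] [MonoidalCategory C]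
    [HasReflexiveCoequalizers C]
    (hleft : ∀ X : C, Monad.PreservesColimitOfIsReflexivePair (tensorLeft X))
    (hright : ∀ X : C, Monad.PreservesColimitOfIsReflexivePair (tensorRight X))
    (P T : Bimonad C) (hP : P.IsHopf) (hT : T.IsHopf)
    (hPres : Monad.PreservesColimitOfIsReflexivePair P.toFunctor)
    (r : Retract T P) :
    ∃ A : Hopf (Center T.Mod),
      IsIso (HopfObj.antipode : A.X ⟶ A.X) ∧
      (Bimonad.boson T A.X).IsHopf ∧
      ∃ φ : P ≅ Bimonad.boson T A.X,
        r.i ≫ φ.hom = Bimonad.bosonInl T A.X ∧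
        φ.hom ≫ Bimonad.bosonPr T A.X = r.r ∧
        Bimonad.bosonInl T A.X ≫ Bimonad.bosonPr T A.X = 𝟙 T := by
  obtain ⟨I⟩ := Bimonad.nonempty_inducedUnit hleft hright hP hT hPres r.i
  let φ : P ≅ Bimonad.boson T I.central :=
    Bimonad.isoOfComponents I.bosonHom I.comparisonInv I.comparison_comparisonInv
      I.comparisonInv_comparison
  have h1 : r.i ≫ φ.hom = Bimonad.bosonInl T I.central :=
    Bimonad.hom_ext fun X => I.app_comparison X
  have h2 : φ.hom ≫ Bimonad.bosonPr T I.central = r.r :=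
    Bimonad.hom_ext fun X => I.comparison_counit_whiskerRight X
  -- The cross product is Hopf because it is isomorphic to `P`, and `π ι = π φ f = g f = 1`.
  exact ⟨⟨I.central⟩, I.isIso_antipode, hP.of_iso φ, φ, h1, h2, by
    change Bimonad.bosonInl T I.central ≫ Bimonad.bosonPr T I.central = 𝟙 T
    rw [← h1, Category.assoc, h2, r.retract]⟩
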